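/- **Conventions.** Permutations are written as words $\pi=\pi_1\cdots\pi_n$ in the letters $1,\dots,n$, $n\ge 0$; $\mathrm{red}(w)$ is the word obtained from $w$ by replacing its $i$-th smallest letter(s) by $i$. A vincular pattern is a pair $(\sigma,X)$ with $\sigma$ a permutation of length $k$ and $X\subseteq\{1,\dots,k-1\}$; $\pi$ contains it if there are $i_1<\dots<i_k$ with $\mathrm{red}(\pi_{i_1}\cdots\pi_{i_k})=\sigma$ and $i_{x+1}=i_x+1$ for all $x\in X$. For a set $B$ of vincular patterns, $S_n(B)$ is the set of permutations of length $n$ containing no pattern of $B$. For a permutation $p$ of length $k$ and $w\in\{1,\dots,n\}^k$ with $\mathrm{red}(w)=p$, $S_n(B)[p;w]$ is the set of $\pi\in S_n(B)$ with $\pi_1\cdots\pi_k=w$. For a set $R$ of indices, $d_R(\pi)$ is obtained from $\pi$ by omitting $\pi_r$ for $r\in R$ and reducing; $d_R(w)$, for a word $w$ with distinct letters, by omitting $w_r$ for $r\in R$ and subtracting $|\{r\in R: w_r<w_i\}|$ from each remaining $w_i$. **Enumeration schemes.** If $c_1<\dots<c_k$ are the letters of $w$ and $c_0=0$, $c_{k+1}=n+1$,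 the spacing vector is $\vec g(n,w)=(c_i-c_{i-1}-1)_{1\le i\le k+1}$. A vector $\vec v\in\mathbb N^{k+1}$ is a gap vector for $p$ if, for all $n$ and all $w$, $\vec g(n,w)\ge\vec v$ (componentwise) implies $S_n(B)[p;w]=\emptyset$. A set $R\subseteq\{1,\dots,k\}$ is reversibly deletable for $p$ if $d_R:S_n(B)[p;w]\to S_{n-|R|}(B)[d_R(p);d_R(w)]$ is a bijection for all $n$ and all $w$ such that $\vec g(n,w)\ge \vec v$ holds for no gap vector $\vec v$ of $p$. An enumeration scheme for $B$ is a set $E$ of triples $(p,G,R)$, where $G$ is a finite set of gap vectors for $p$ and $R$ is reversibly deletable for $p$, such that $(\epsilon,\emptyset,\emptyset)\in E$ (with $\epsilon$ the empty permutation) and for each $(p,G,R)\in E$: if $R=\emptyset$ and $\vec 0\notin G$, then every child of $p$ (every $p'$ of length $k+1$ with $\mathrm{red}(p'_1\cdots p'_k)=p$) is the first entry of a triple of $E$; if $R\neq\emptyset$, then so is $d_R(p)$. **Statistics.** A permutation statistic is a function $f$ from the set of all permutations to $\mathbb Z$. It is ES-compatible with margin $m$ if for all $t\ge1$ and $R\subseteq\{1,\dots,t\}$,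 $f(\pi)-f(d_R(\pi))=f(\pi')-f(d_R(\pi'))$ whenever $\pi,\pi'$ have the same length $n\ge t+m$ and $\pi_1\cdots\pi_{t+m}=\pi'_1\cdots\pi'_{t+m}$. For $\mathbf f=(f_1,\dots,f_s)$ and indeterminates $q_1,\dots,q_s$, the distribution over a finite set $S$ is the Laurent polynomial $F(S,\mathbf f,\mathbf q)=\sum_{\pi\in S}q_1^{f_1(\pi)}\cdots q_s^{f_s(\pi)}$. **Machine model.** A random access machine with a memory of integers and a memory of Laurent polynomials in $q_1,\dots,q_s$ with integer coefficients. One step is: setting an integer cell to a constant, adding or subtracting integers, copying integers with indirect addressing, testing whether an integer is positive (to branch or loop), setting a polynomial cell to $1$, adding two polynomials, or multiplying a polynomial by $q_1^{e_1}\cdots q_s^{e_s}$ with $e_1,\dots,e_s$ taken from the integer memory; polynomials cannot be inspected. The statistics are given as oracles: for a permutation $\pi$ stored letter by letter, $f_i(\pi)$ is obtained in $1+|\pi|$ steps. The *cost* of a run is the number of steps, increased for each polynomial operation by the number of terms of its operands. **Theorem.** Let $B$ be a set of vincular patterns that has a finite enumeration scheme, and let $s,m\ge0$. There are a program $P$ and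 a constant $C$, depending only on $B,s,m$, such that for all permutation statistics $f_1,\dots,f_s$ that are ES-compatible with margin $m$ and all $n\ge0$, the program $P$, on input $n$ and with oracles $f_1,\dots,f_s$, computes $F(S_n(B),\mathbf f,\mathbf q)$ in at most $C(n+1)^C$ steps and with cost at most $C(n+1)^C(1+N_n)$, where $N_n$ is the largest number of different values that $\mathbf f$ takes on one of the sets $S_0(B),\dots,S_n(B)$. (The case $s=1$ is the computation of $F(S_n(B),f,q)$ for a single statistic. If $f_1,\dots,f_s$ are polynomially bounded in $n$, then so are $N_n$ and the cost.) -/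

import Mathlib

namespace EnumScheme

/-! ### Permutations in one-line notation -/

/-- `w` is a rearrangement of the letters `1, …, |w|`. -/
def IsPermutation (w : List ℕ) : Prop :=
  w.Perm (List.range' 1 w.length)

/-- Permutations of all lengths `n ≥ 0`, written as words `π₁ π₂ ⋯ πₙ` in the letters `1, …, n`. -/
abbrev Permutation : Type := {w : List ℕ // IsPermutation w}

/-- The length of a permutation. -/
def Permutation.length (π : Permutation) : ℕ := π.1.length

/-- The empty permutation. -/
def emptyPerm : Permutation := ⟨[], List.Perm.refl _⟩

/-- Reduction of a word: the `i`-th smallest letter(s) are replaced by `i`. -/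
def red (w : List ℕ) : List ℕ :=
  w.map fun a => (w.toFinset.filter (· ≤ a)).card

/-- The letters of `w` at the positions (numbered from `1`) that satisfy `P`. -/
def lettersAt (P : ℕ → Prop) [DecidablePred P] (w : List ℕ) : List ℕ :=
  ((w.zipIdx 1).filter fun x => P x.2).map Prod.fst

theorem isPermutation_red {w : List ℕ} (hw : w.Nodup) : IsPermutation (red w) := by
  have hlen : (red w).length = w.length := by simp [red]
  have hnd : (red w).Nodup := by
    refine List.Nodup.map_on ?_ hw
    intro a ha b hb hab
    by_contra hne
    wlog hlt : a < b generalizing a b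
    · exact this b hb a ha hab.symm (Ne.symm hne) (by omega)
    refine absurd hab (ne_of_lt (Finset.card_lt_card ?_))
    rw [Finset.ssubset_iff_of_subset]
    · exact ⟨b, by simp [hb], by simp [hlt]⟩
    · intro x hx
      simp only [Finset.mem_filter] at hx ⊢
      exact ⟨hx.1, hx.2.trans hlt.le⟩
  have hsub : red w ⊆ List.range' 1 w.length := by
    intro x hx
    obtain ⟨a, ha, rfl⟩ := List.mem_map.1 hx
    rw [List.mem_range'_1]
    have h1 : 0 < (w.toFinset.filter (· ≤ a)).card :=
      Finset.card_pos.2 ⟨a, by simp [ha]⟩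
    have h2 : (w.toFinset.filter (· ≤ a)).card ≤ w.length :=
      (Finset.card_filter_le _ _).trans (List.toFinset_card_le w)
    omega
  unfold IsPermutation
  rw [hlen]
  exact (List.subperm_of_subset hnd hsub).perm_of_length_le (by simp [hlen])

theorem nodup_lettersAt (P : ℕ → Prop) [DecidablePred P] {w : List ℕ} (hw : w.Nodup) :
    (lettersAt P w).Nodup := by
  have h : (lettersAt P w).Sublist ((w.zipIdx 1).map Prod.fst) :=
    List.Sublist.map Prod.fst List.filter_sublist
  rw [List.zipIdx_map_fst] at h
  exact h.nodup hw

theorem IsPermutation.nodup {w : List ℕ} (hw : IsPermutation w) : w.Nodup :=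
  (List.Perm.nodup_iff hw).2 (List.nodup_range' (step := 1))

/-- The deletion `d_R` on permutations: omit `π_r` for every `r ∈ R`, then reduce. -/
def deletePerm (R : Finset ℕ) (π : Permutation) : Permutation :=
  ⟨red (lettersAt (· ∉ R) π.1), isPermutation_red (nodup_lettersAt _ π.2.nodup)⟩

/-- The deletion `d_R` on words without repeated letters: omit `w_r` for every `r ∈ R`, then
subtract `|{r ∈ R : w_r < w_i}|` from every remaining letter `w_i`. -/
def deleteWord (R : Finset ℕ) (w : List ℕ) : List ℕ :=
  (lettersAt (· ∉ R) w).map fun a => a - (lettersAt (· ∈ R) w).countP (· < a)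

/-! ### Vincular patterns -/

/-- A vincular pattern `(σ, X)` of length `k`, with `σ` a permutation of length `k` and
`X ⊆ {1, …, k - 1}`. -/
structure VincularPattern where
  perm : Permutation
  adj : Finset ℕ
  one_le_adj : ∀ x ∈ adj, 1 ≤ x
  adj_lt : ∀ x ∈ adj, x < perm.length

/-- `π` contains `(σ, X)`: there are positions `i₁ < ⋯ < i_k` such that the letters of `π` at
these positions reduce to `σ`, and `i_{x+1} = i_x + 1` for each `x ∈ X`.  (Positions are numbered
from `0` in this definition, elements of `X` from `1`.) -/
def Contains (π : Permutation) (τ : VincularPattern) : Prop :=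
  ∃ i : Fin τ.perm.length → Fin π.length, StrictMono i ∧
    red (List.ofFn fun j => π.1.get (i j)) = τ.perm.1 ∧
    ∀ (x : ℕ) (hx : x + 1 < τ.perm.length), x + 1 ∈ τ.adj →
      (i ⟨x + 1, hx⟩ : ℕ) = (i ⟨x, Nat.lt_of_succ_lt hx⟩ : ℕ) + 1

open Classical in
/-- `S_n(B)`: the permutations of length `n` that avoid every pattern in `B`. -/
noncomputable def avoiders (n : ℕ) (B : Set VincularPattern) : Finset Permutation :=
  ((List.range' 1 n).permutations.toFinset.subtype IsPermutation).filter
    fun π => ∀ τ ∈ B, ¬ Contains π τ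

/-- `S_n(B)[p; w]`: the permutations `π ∈ S_n(B)` with `red(π₁ ⋯ π_k) = p` and `π₁ ⋯ π_k = w`,
where `k = |p|`. -/
def prefixClass (n : ℕ) (B : Set VincularPattern) (p : Permutation) (w : List ℕ) :
    Set Permutation :=
  {π | π ∈ avoiders n B ∧ red (π.1.take p.length) = p.1 ∧ π.1.take p.length = w}

/-! ### Gap vectors, reversible deletions, enumeration schemes -/

/-- `w ∈ [n]^k` with `red(w) = p`, where `k = |p|`. -/
def IsPrefixWord (n : ℕ) (p : Permutation) (w : List ℕ) : Prop :=
  (∀ a ∈ w, 1 ≤ a ∧ a ≤ n) ∧ red w = p.1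

/-- The spacing vector `g(n, w)` of a word `w` of length `k`: with `c₁ < ⋯ < c_k` the letters of
`w` in increasing order, `c₀ = 0` and `c_{k+1} = n + 1`, its components are
`c_i - c_{i-1} - 1` for `1 ≤ i ≤ k + 1`. -/
def spacing (n k : ℕ) (w : List ℕ) : Fin (k + 1) → ℕ := fun i =>
  let c := 0 :: (w.insertionSort (· ≤ ·) ++ [n + 1])
  c.getD (i + 1) 0 - c.getD i 0 - 1

/-- `v` is a gap vector for the prefix `p` with respect to `B`. -/
def IsGapVector (B : Set VincularPattern) (p : Permutation) (v : Fin (p.length + 1) → ℕ) : Prop :=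
  ∀ (n : ℕ) (w : List ℕ), IsPrefixWord n p w → v ≤ spacing n p.length w →
    prefixClass n B p w = ∅

/-- `R ⊆ [|p|]` is reversibly deletable for `p` with respect to `B`: the map
`d_R : S_n(B)[p; w] → S_{n-|R|}(B)[d_R(p); d_R(w)]` is a bijection for all words `w` that fail the
gap vector criterion for every gap vector of `p` with respect to `B`. -/
def IsReversiblyDeletable (B : Set VincularPattern) (p : Permutation) (R : Finset ℕ) : Prop :=
  R ⊆ Finset.Icc 1 p.length ∧
  ∀ (n : ℕ) (w : List ℕ), IsPrefixWord n p w →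
    (∀ v, IsGapVector B p v → ¬ v ≤ spacing n p.length w) →
    Set.BijOn (deletePerm R) (prefixClass n B p w)
      (prefixClass (n - R.card) B (deletePerm R p) (deleteWord R w))

/-- `p'` is a child of `p`: it is one letter longer, and `red(p'₁ ⋯ p'_k) = p` for `k = |p|`. -/
def IsChild (p' p : Permutation) : Prop :=
  p'.length = p.length + 1 ∧ red (p'.1.take p.length) = p.1

/-- A triple `(p, G, R)`. -/
structure Triple where
  perm : Permutation
  gaps : Finset (Fin (perm.length + 1) → ℕ)
  del : Finset ℕ

/-- `E` is an enumeration scheme for `B`.  The set `G` of a triple `(p, G, R)` may be any finite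
set of gap vectors for `p`; it need not generate all of them. -/
structure IsEnumerationScheme (B : Set VincularPattern) (E : Set Triple) : Prop where
  gap : ∀ T ∈ E, ∀ v ∈ T.gaps, IsGapVector B T.perm v
  deletable : ∀ T ∈ E, IsReversiblyDeletable B T.perm T.del
  root : (⟨emptyPerm, ∅, ∅⟩ : Triple) ∈ E
  children : ∀ T ∈ E, T.del = ∅ → 0 ∉ T.gaps →
    ∀ p', IsChild p' T.perm → ∃ T' ∈ E, T'.perm = p'
  image : ∀ T ∈ E, T.del ≠ ∅ → ∃ T' ∈ E, T'.perm = deletePerm T.del T.perm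

/-- `B` admits a finite enumeration scheme. -/
def HasFiniteScheme (B : Set VincularPattern) : Prop :=
  ∃ E : Set Triple, E.Finite ∧ IsEnumerationScheme B E

/-! ### Permutation statistics and their distributions -/

/-- The permutation statistic `f` is ES-compatible with margin `m`: for every `t ≥ 1` and every
`R ⊆ [t]`, the difference `f(π) - f(d_R(π))` depends only on the length of `π` and on its first
`t + m` letters, for `π` of length at least `t + m`. -/
def ESCompatible (f : Permutation → ℤ) (m : ℕ) : Prop :=
  ∀ t : ℕ, 1 ≤ t → ∀ R : Finset ℕ, R ⊆ Finset.Icc 1 t → ∀ π π' : Permutation,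
    π.length = π'.length → t + m ≤ π.length → π.1.take (t + m) = π'.1.take (t + m) →
    f π - f (deletePerm R π) = f π' - f (deletePerm R π')

/-- Laurent polynomials with integer coefficients in `s` indeterminates `q₁, …, q_s`. -/
abbrev Laurent (s : ℕ) : Type := AddMonoidAlgebra ℤ (Fin s → ℤ)

/-- The monomial `q₁^{e₁} ⋯ q_s^{e_s}`. -/
noncomputable def monomial {s : ℕ} (e : Fin s → ℤ) : Laurent s := AddMonoidAlgebra.single e 1

/-- The distribution `F(S, f, q)`, the sum of `q₁^{f₁(π)} ⋯ q_s^{f_s(π)}` over `π ∈ S`. -/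
noncomputable def distribution {s : ℕ} (S : Finset Permutation) (f : Fin s → Permutation → ℤ) :
    Laurent s :=
  ∑ π ∈ S, monomial fun i => f i π

/-- The largest number of different values that `(f₁, …, f_s)` takes on one of the sets
`S_0(B), …, S_n(B)`. -/
noncomputable def maxValues {s : ℕ} (B : Set VincularPattern) (f : Fin s → Permutation → ℤ)
    (n : ℕ) : ℕ :=
  (Finset.range (n + 1)).sup fun j => ((avoiders j B).image fun π i => f i π).card

/-! ### The machine model

A random access machine with two memories indexed by `ℤ`: one holds integers, the other Laurent
polynomials.  Integers can be added, subtracted, compared with `0` and used as addresses; Laurent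
polynomials can be added and multiplied by a monomial, but not inspected.  A statistic can be
evaluated at a permutation that is stored in memory letter by letter. -/

/-- Memory contents. -/
structure State (s : ℕ) where
  int : ℤ → ℤ
  poly : ℤ → Laurent s

/-- Programs.  The parameters `x`, `y`, `z`, `e i` are addresses of cells of the integer memory;
cells of the polynomial memory are addressed indirectly, through the content of such a cell. -/
inductive Program (s : ℕ) : Type
  /-- do nothing -/
  | skip
  /-- `int[x] := c` -/
  | const (x c : ℤ)
  /-- `int[x] := int[y] + int[z]` -/
  | add (x y z : ℤ)
  /-- `int[x] := int[y] - int[z]` -/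
  | sub (x y z : ℤ)
  /-- `int[x] := int[int[y]]` -/
  | load (x y : ℤ)
  /-- `int[int[x]] := int[y]` -/
  | store (x y : ℤ)
  /-- `int[x] := f_i(π)`, where `π` is the permutation of length `int[z]` that is stored in the
  integer memory from address `int[y]` on -/
  | query (x : ℤ) (i : Fin s) (y z : ℤ)
  /-- `poly[int[x]] := 1` -/
  | one (x : ℤ)
  /-- `poly[int[x]] := poly[int[y]] + poly[int[z]]` -/
  | polyAdd (x y z : ℤ)
  /-- `poly[int[x]] := q₁^{int[e 1]} ⋯ q_s^{int[e s]} * poly[int[y]]` -/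
  | shift (x : ℤ) (e : Fin s → ℤ) (y : ℤ)
  /-- first `P`, then `Q` -/
  | seq (P Q : Program s)
  /-- `P` if `int[x] > 0`, otherwise `Q` -/
  | ifPos (x : ℤ) (P Q : Program s)
  /-- repeat `P` as long as `int[x] > 0` -/
  | whilePos (x : ℤ) (P : Program s)

namespace State

variable {s : ℕ}

/-- Write `c` into cell `x` of the integer memory. -/
def setInt (σ : State s) (x c : ℤ) : State s := { σ with int := Function.update σ.int x c }

/-- Write `a` into cell `x` of the polynomial memory. -/
noncomputable def setPoly (σ : State s) (x : ℤ) (a : Laurent s) : State s :=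
  { σ with poly := Function.update σ.poly x a }

/-- The permutation `π` is stored in the integer memory from address `a` on. -/
def Stores (σ : State s) (a : ℤ) (π : Permutation) : Prop :=
  ∀ j : Fin π.length, σ.int (a + (j : ℕ)) = (π.1.get j : ℤ)

/-- The initial state on input `n`: cell `0` of the integer memory holds `n`, and all other cells
of both memories hold `0`. -/
noncomputable def init (s n : ℕ) : State s where
  int := Function.update 0 0 (n : ℤ)
  poly := 0

end State

/-- The number of terms of a Laurent polynomial. -/
def terms {s : ℕ} (a : Laurent s) : ℕ := (AddMonoidAlgebra.coeff a).support.card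

/-- `Run f P σ σ' t u`: with access to the statistics `f`, the program `P` started in state `σ`
halts in state `σ'` after `t` steps with total cost `u`.  Every elementary operation and every test
is one step, except that a query about a permutation of length `ℓ` counts as `1 + ℓ` steps.
The cost of a polynomial operation is moreover increased by the number of terms of its operands.
A query is not executable unless a permutation is stored where it says. -/
inductive Run {s : ℕ} (f : Fin s → Permutation → ℤ) :
    Program s → State s → State s → ℕ → ℕ → Prop
  | skip (σ : State s) : Run f .skip σ σ 1 1
  | const (σ : State s) (x c : ℤ) : Run f (.const x c) σ (σ.setInt x c) 1 1
  | add (σ : State s) (x y z : ℤ) :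
      Run f (.add x y z) σ (σ.setInt x (σ.int y + σ.int z)) 1 1
  | sub (σ : State s) (x y z : ℤ) :
      Run f (.sub x y z) σ (σ.setInt x (σ.int y - σ.int z)) 1 1
  | load (σ : State s) (x y : ℤ) :
      Run f (.load x y) σ (σ.setInt x (σ.int (σ.int y))) 1 1
  | store (σ : State s) (x y : ℤ) :
      Run f (.store x y) σ (σ.setInt (σ.int x) (σ.int y)) 1 1
  | query (σ : State s) (x : ℤ) (i : Fin s) (y z : ℤ) (π : Permutation)
      (hlen : σ.int z = (π.length : ℤ)) (hπ : σ.Stores (σ.int y) π) :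
      Run f (.query x i y z) σ (σ.setInt x (f i π)) (1 + π.length) (1 + π.length)
  | one (σ : State s) (x : ℤ) :
      Run f (.one x) σ (σ.setPoly (σ.int x) 1) 1 1
  | polyAdd (σ : State s) (x y z : ℤ) :
      Run f (.polyAdd x y z) σ
        (σ.setPoly (σ.int x) (σ.poly (σ.int y) + σ.poly (σ.int z)))
        1 (1 + terms (σ.poly (σ.int y)) + terms (σ.poly (σ.int z)))
  | shift (σ : State s) (x : ℤ) (e : Fin s → ℤ) (y : ℤ) :
      Run f (.shift x e y) σ
        (σ.setPoly (σ.int x) (monomial (fun i => σ.int (e i)) * σ.poly (σ.int y)))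
        1 (1 + terms (σ.poly (σ.int y)))
  | seq {P Q : Program s} {σ₁ σ₂ σ₃ : State s} {t₁ t₂ u₁ u₂ : ℕ}
      (h₁ : Run f P σ₁ σ₂ t₁ u₁) (h₂ : Run f Q σ₂ σ₃ t₂ u₂) :
      Run f (.seq P Q) σ₁ σ₃ (t₁ + t₂) (u₁ + u₂)
  | if_pos {x : ℤ} {P Q : Program s} {σ σ' : State s} {t u : ℕ}
      (hx : 0 < σ.int x) (h : Run f P σ σ' t u) :
      Run f (.ifPos x P Q) σ σ' (1 + t) (1 + u)
  | if_not_pos {x : ℤ} {P Q : Program s} {σ σ' : State s} {t u : ℕ}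
      (hx : ¬ 0 < σ.int x) (h : Run f Q σ σ' t u) :
      Run f (.ifPos x P Q) σ σ' (1 + t) (1 + u)
  | while_stop {x : ℤ} {P : Program s} {σ : State s} (hx : ¬ 0 < σ.int x) :
      Run f (.whilePos x P) σ σ 1 1
  | while_loop {x : ℤ} {P : Program s} {σ₁ σ₂ σ₃ : State s} {t₁ t₂ u₁ u₂ : ℕ}
      (hx : 0 < σ₁.int x) (h₁ : Run f P σ₁ σ₂ t₁ u₁)
      (h₂ : Run f (.whilePos x P) σ₂ σ₃ t₂ u₂) :
      Run f (.whilePos x P) σ₁ σ₃ (1 + t₁ + t₂) (1 + u₁ + u₂)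

end EnumScheme

open EnumScheme

/-! The proof is dynamic programming over prefixes of one fixed length. Let `K` bound the lengths of
the permutations in the scheme and put `L = K + 1 + m`. For `j ≥ L` and a word `v` of length `L`,
consider the cylinder of all `π` in `S_j(B)` that begin with `v`. Some prefix of `v` of length at
most `K` reduces to a `p` with a triple `(p, G, R)` such that `R ≠ ∅` or `0 ∈ G`; otherwise the
scheme would have to contain children of unbounded length (`exists_applies`). If the prefix
satisfies some gap vector, the cylinder is empty. Otherwise `R ≠ ∅`, and `d_R` maps the cylinder of
`(j, v)` bijectively onto that of `(j - |R|, d_R(v))` (`bijOn_cylinder`).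

Compatibility with `t = K + 1` makes `f(π) - f(d_R(π))` constant on all permutations of length `j`
that begin with `v`, whether they avoid `B` or not. So it can be read off from one explicit
permutation, `v` followed by the other letters in increasing order, and deletion takes such a
permutation to one of the same kind (`deletePerm_extPerm`). The distribution over the cylinder is
therefore a known monomial times that of a cylinder in smaller permutations (`labelCorrect_label`).

Since `d_R(v)` is shorter than `L`, the table has entries for all words of length at most `L`: each
entry computed at length `L` is added to the cells of all its prefixes (`Table.insert`). The entry
for `(n, ε)` is the answer. There are polynomially many words of length `L`, and the finitely many
permutations shorter than `L` are built into the program.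

The machine must choose the rule for `v`, although reversible deletability refers to all gap vectors
of `p`. The vectors lying above a gap vector form an upper set, so by Dickson's lemma only a bounded
part of the spacing vector matters. The rule thus depends on finitely many comparisons of
differences of `0`, `j` and letters of `v` with constants, and a fixed decision tree exists
(`exists_tree`); the tree depends on `B` and `m` only.

For the cost, the operands of polynomial operations are distributions over sets of avoiders of
length at most `max n L`, apart from the constants `0` and `1`; so the number of their terms is at
most `N_n` plus a constant. -/

namespace EnumScheme

/-! ### Running programs with a bound on steps and cost -/

/-- Started in `σ`, the program `P` halts after at most `T` steps, with cost at most
`T * (1 + 2 * W)`, in a state that satisfies `Q`. -/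
def Exec {s : ℕ} (f : Fin s → Permutation → ℤ) (W : ℕ) (P : Program s) (T : ℕ) (σ : State s)
    (Q : State s → Prop) : Prop :=
  ∃ σ' t u, Run f P σ σ' t u ∧ t ≤ T ∧ u ≤ T * (1 + 2 * W) ∧ Q σ'

/-! ### Reading memory after a write -/

section

variable {s : ℕ}

@[simp] theorem State.setInt_int (σ : State s) (x c y : ℤ) :
    (σ.setInt x c).int y = if y = x then c else σ.int y := by
  simp [State.setInt, Function.update_apply]

@[simp] theorem State.setInt_poly (σ : State s) (x c : ℤ) : (σ.setInt x c).poly = σ.poly := rfl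

@[simp] theorem State.setPoly_int (σ : State s) (x : ℤ) (a : Laurent s) :
    (σ.setPoly x a).int = σ.int := rfl

@[simp] theorem State.setPoly_poly (σ : State s) (x : ℤ) (a : Laurent s) (y : ℤ) :
    (σ.setPoly x a).poly y = if y = x then a else σ.poly y := by
  simp [State.setPoly, Function.update_apply]

end

namespace Exec

variable {s : ℕ} {f : Fin s → Permutation → ℤ} {W : ℕ} {P P' : Program s} {T T' : ℕ}
  {σ : State s} {Q Q' : State s → Prop}

theorem weaken (h : Exec f W P T σ Q) (hT : T ≤ T') (hQ : ∀ σ', Q σ' → Q' σ') :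
    Exec f W P T' σ Q' := by
  obtain ⟨σ', t, u, hr, ht, hu, hq⟩ := h
  exact ⟨σ', t, u, hr, ht.trans hT, hu.trans (Nat.mul_le_mul_right _ hT), hQ _ hq⟩

theorem le (h : Exec f W P T σ Q) (hT : T ≤ T') : Exec f W P T' σ Q := h.weaken hT fun _ => id

theorem imp (h : Exec f W P T σ Q) (hQ : ∀ σ', Q σ' → Q' σ') : Exec f W P T σ Q' :=
  h.weaken le_rfl hQ

theorem seq (h₁ : Exec f W P T σ Q) (h₂ : ∀ σ', Q σ' → Exec f W P' T' σ' Q') :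
    Exec f W (.seq P P') (T + T') σ Q' := by
  obtain ⟨σ₁, t₁, u₁, hr₁, ht₁, hu₁, hq₁⟩ := h₁
  obtain ⟨σ₂, t₂, u₂, hr₂, ht₂, hu₂, hq₂⟩ := h₂ _ hq₁
  exact ⟨σ₂, _, _, .seq hr₁ hr₂, by omega, by rw [add_mul]; omega, hq₂⟩

theorem step {t : ℕ} {σ' : State s} (h : Run f P σ σ' t t) (hT : t ≤ T) (hQ : Q σ') :
    Exec f W P T σ Q := ⟨σ', t, t, h, hT, by nlinarith, hQ⟩

theorem skip (h : Q σ) : Exec f W .skip 1 σ Q := step (.skip σ) le_rfl h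

theorem const {x c : ℤ} (h : Q (σ.setInt x c)) : Exec f W (.const x c) 1 σ Q :=
  step (.const σ x c) le_rfl h

theorem add {x y z : ℤ} (h : Q (σ.setInt x (σ.int y + σ.int z))) :
    Exec f W (.add x y z) 1 σ Q := step (.add σ x y z) le_rfl h

theorem sub {x y z : ℤ} (h : Q (σ.setInt x (σ.int y - σ.int z))) :
    Exec f W (.sub x y z) 1 σ Q := step (.sub σ x y z) le_rfl h

theorem store {x y : ℤ} (h : Q (σ.setInt (σ.int x) (σ.int y))) :
    Exec f W (.store x y) 1 σ Q := step (.store σ x y) le_rfl h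

theorem one {x : ℤ} (h : Q (σ.setPoly (σ.int x) 1)) : Exec f W (.one x) 1 σ Q :=
  step (.one σ x) le_rfl h

theorem polyAdd {x y z : ℤ} (hy : terms (σ.poly (σ.int y)) ≤ W)
    (hz : terms (σ.poly (σ.int z)) ≤ W)
    (h : Q (σ.setPoly (σ.int x) (σ.poly (σ.int y) + σ.poly (σ.int z)))) :
    Exec f W (.polyAdd x y z) 1 σ Q :=
  ⟨_, _, _, .polyAdd σ x y z, le_rfl, by omega, h⟩

theorem shift {x y : ℤ} {e : Fin s → ℤ} (hy : terms (σ.poly (σ.int y)) ≤ W)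
    (h : Q (σ.setPoly (σ.int x) (monomial (fun i => σ.int (e i)) * σ.poly (σ.int y)))) :
    Exec f W (.shift x e y) 1 σ Q :=
  ⟨_, _, _, .shift σ x e y, le_rfl, by omega, h⟩

theorem query {x y z : ℤ} {i : Fin s} {π : Permutation} (hlen : σ.int z = (π.length : ℤ))
    (hπ : σ.Stores (σ.int y) π) (h : Q (σ.setInt x (f i π))) :
    Exec f W (.query x i y z) (1 + π.length) σ Q :=
  step (.query σ x i y z π hlen hπ) le_rfl h

theorem ifPos {x : ℤ} (h₁ : 0 < σ.int x → Exec f W P T σ Q)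
    (h₂ : ¬ 0 < σ.int x → Exec f W P' T σ Q) : Exec f W (.ifPos x P P') (1 + T) σ Q := by
  by_cases hx : 0 < σ.int x
  · obtain ⟨σ', t, u, hr, ht, hu, hq⟩ := h₁ hx
    exact ⟨σ', _, _, .if_pos hx hr, by omega, by rw [add_mul]; omega, hq⟩
  · obtain ⟨σ', t, u, hr, ht, hu, hq⟩ := h₂ hx
    exact ⟨σ', _, _, .if_not_pos hx hr, by omega, by rw [add_mul]; omega, hq⟩

/-- Indexing the invariant by the number of rounds left, which cell `x` displays, turns termination
and the time bound into one induction. -/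
theorem whilePos {x : ℤ} (I : ℕ → State s → Prop) (hI : ∀ k σ, I k σ → σ.int x = k)
    (hstep : ∀ k σ, I (k + 1) σ → Exec f W P T σ (I k)) :
    ∀ k σ, I k σ → Exec f W (.whilePos x P) (k * (T + 1) + 1) σ (I 0) := by
  intro k
  induction k with
  | zero =>
    intro σ h
    exact step (Run.while_stop (by simp [hI 0 σ h])) (by simp) h
  | succ k ih =>
    intro σ h
    obtain ⟨σ₁, t₁, u₁, hr₁, ht₁, hu₁, hq₁⟩ := hstep k σ h
    obtain ⟨σ₂, t₂, u₂, hr₂, ht₂, hu₂, hq₂⟩ := ih σ₁ hq₁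
    refine ⟨σ₂, _, _, .while_loop (by rw [hI _ σ h]; positivity) hr₁ hr₂, ?_, ?_, hq₂⟩
    · rw [add_mul]; omega
    · have : ((k + 1) * (T + 1) + 1) * (1 + 2 * W) =
          T * (1 + 2 * W) + (k * (T + 1) + 1) * (1 + 2 * W) + (1 + 2 * W) := by ring
      omega

end Exec

/-- The loop `for x := a + 1, …, lim do P`. -/
def forLoop {s : ℕ} (x lim : ℤ) (a : ℤ) (P : Program s) : Program s :=
  .seq (.const x a) (.seq (.sub (-9) lim x) (.whilePos (-9)
    (.seq (.const (-3) 1) (.seq (.add x x (-3)) (.seq P (.sub (-9) lim x))))))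

/-- Cell `-9` is recomputed from `lim` and `x` after every round, so the body may overwrite it;
hence nested loops can share it. `hscr` says that the invariant ignores this cell. The final index
`max a b` covers the empty loop. -/
theorem Exec.forLoop {s : ℕ} {f : Fin s → Permutation → ℤ} {W : ℕ} {P : Program s} {T : ℕ}
    {σ : State s} {x lim : ℤ} {a b : ℕ} (I : ℕ → State s → Prop) (hx3 : x ≠ -3)
    (hxl : x ≠ lim) (hlim : σ.int lim = b)
    (hI : ∀ k σ, I k σ → σ.int x = k ∧ σ.int lim = b)
    (hscr : ∀ k σ c, I k σ → I k (σ.setInt (-9) c))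
    (hstep : ∀ k σ, a ≤ k → k < b → I k σ →
      Exec f W P T ((σ.setInt (-3) 1).setInt x (k + 1 : ℕ)) (I (k + 1)))
    (h0 : I a (σ.setInt x a)) :
    Exec f W (EnumScheme.forLoop x lim a P) (2 + ((b - a) * (T + 4) + 1)) σ (I (max a b)) := by
  have h1 : Exec f W (EnumScheme.forLoop x lim a P) (1 + (1 + ((b - a) * (T + 3 + 1) + 1))) σ
      (I (max a b)) := by
    refine seq (const rfl) fun σ₁ h₁ => seq (sub rfl) fun σ₂ h₂ => ?_
    by_cases hab : a ≤ b
    · have := whilePos (f := f) (W := W) (x := -9)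
        (P := .seq (.const (-3) 1) (.seq (.add x x (-3)) (.seq P (.sub (-9) lim x)))) (T := T + 3)
        (fun k σ => k + a ≤ b ∧ I (b - k) σ ∧ σ.int (-9) = k) (fun k σ h => h.2.2) ?_
        (b - a) σ₂ ⟨by omega, ?_, ?_⟩
      · exact this.imp fun σ h => by simpa [max_eq_right hab] using h.2.1
      · rintro k σ ⟨hk, hIk, -⟩
        have hx := (hI _ _ hIk).1
        refine (seq (const rfl) fun σ₃ h₃ => seq (add rfl) fun σ₄ h₄ =>
          seq (Q := I (b - k)) (T := T) ?_ fun σ₅ h₅ => sub ?_).le (T := 1 + (1 + (T + 1)))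
            (by omega)
        · have := hstep (b - (k + 1)) σ (by omega) (by omega) hIk
          rw [show b - (k + 1) + 1 = b - k by omega] at this
          subst h₃; subst h₄
          simpa [hx, hx3, show ((b - (k + 1) : ℕ) : ℤ) + 1 = (b - k : ℕ) by omega] using this
        · refine ⟨by omega, hscr _ _ _ h₅, ?_⟩
          have := hI _ _ h₅
          simp [this]; omega
      · subst h₂; subst h₁
        rw [show b - (b - a) = a by omega]
        exact hscr _ _ _ h0
      · subst h₂; subst h₁
        simp [hxl.symm, hlim]; omega
    · refine step (t := 1) (σ' := σ₂) (Run.while_stop ?_) (by omega) ?_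
      · subst h₂; subst h₁
        simp [hxl.symm, hlim]; omega
      · subst h₂; subst h₁
        rw [max_eq_left (by omega)]
        exact hscr _ _ _ h0
  exact h1.le (Nat.le_of_eq (by ring))

/-! ### Coding words as addresses -/

/-- An injective coding of words by natural numbers. -/
def enc : List ℕ → ℕ
  | [] => 0
  | x :: l => 2 ^ x * (2 * enc l + 1)

theorem enc_cons_pos (x : ℕ) (l : List ℕ) : 0 < enc (x :: l) := by
  simp [enc]

/-- Parity decides whether an exponent is zero; otherwise a factor of two cancels. -/
theorem two_pow_mul_odd_inj {x y a b : ℕ} (h : 2 ^ x * (2 * a + 1) = 2 ^ y * (2 * b + 1)) :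
    x = y ∧ a = b := by
  induction x generalizing y with
  | zero =>
    cases y with
    | zero => simp at h; exact ⟨rfl, h⟩
    | succ y => rw [pow_succ, mul_comm (2 ^ y), mul_assoc] at h; simp at h; omega
  | succ x ih =>
    cases y with
    | zero => rw [pow_succ, mul_comm (2 ^ x), mul_assoc] at h; simp at h; omega
    | succ y =>
      rw [pow_succ, pow_succ, mul_comm (2 ^ x), mul_comm (2 ^ y), mul_assoc, mul_assoc] at h
      have := ih (Nat.eq_of_mul_eq_mul_left two_pos h)
      omega

theorem enc_injective : Function.Injective enc := by
  intro l
  induction l with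
  | nil =>
    intro l' h
    cases l' with
    | nil => rfl
    | cons x l' => have := enc_cons_pos x l'; simp [enc] at h
  | cons x l ih =>
    intro l' h
    cases l' with
    | nil => have := enc_cons_pos x l; simp [enc] at h
    | cons y l' =>
      obtain ⟨h1, h2⟩ := two_pow_mul_odd_inj h
      rw [h1, ih h2]

/-! ### Registers

The cells with addresses greater than `-10` are scratch memory; words are kept in registers whose
addresses are at most `-10`. -/

/-- `σ'` agrees with `σ` except for scratch memory. -/
def SameRegs {s : ℕ} (σ σ' : State s) : Prop :=
  σ'.poly = σ.poly ∧ ∀ a ≤ -10, σ'.int a = σ.int a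

theorem SameRegs.refl {s : ℕ} (σ : State s) : SameRegs σ σ := ⟨rfl, fun _ _ => rfl⟩

theorem SameRegs.trans {s : ℕ} {σ σ' σ'' : State s} (h : SameRegs σ σ') (h' : SameRegs σ' σ'') :
    SameRegs σ σ'' := ⟨h'.1.trans h.1, fun a ha => (h'.2 a ha).trans (h.2 a ha)⟩

theorem SameRegs.setInt {s : ℕ} {σ σ' : State s} (h : SameRegs σ σ') {x c : ℤ} (hx : -10 < x) :
    SameRegs σ (σ'.setInt x c) :=
  ⟨h.1, fun a ha => by simp [show a ≠ x by omega, h.2 a ha]⟩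

/-- The word `l` is kept in the registers `as`. -/
def Holds {s : ℕ} (σ : State s) (as : List ℤ) (l : List ℕ) : Prop :=
  List.Forall₂ (fun (a : ℤ) (x : ℕ) => a ≤ -10 ∧ σ.int a = (x : ℤ)) as l

theorem Holds.congr {s : ℕ} {σ σ' : State s} {as : List ℤ} {l : List ℕ} (h : Holds σ as l)
    (h' : ∀ a ∈ as, σ'.int a = σ.int a) : Holds σ' as l := by
  induction h with
  | nil => exact .nil
  | cons hab _ ih =>
    exact .cons ⟨hab.1, (h' _ (by simp)).trans hab.2⟩ (ih fun a ha => h' a (by simp [ha]))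

theorem Holds.le {s : ℕ} {σ : State s} {as : List ℤ} {l : List ℕ} (h : Holds σ as l) :
    ∀ a ∈ as, a ≤ -10 := by
  induction h with
  | nil => simp
  | cons hab _ ih => simpa using ⟨hab.1, by simpa using ih⟩

theorem Holds.of_same {s : ℕ} {σ σ' : State s} {as : List ℤ} {l : List ℕ} (h : Holds σ as l)
    (h' : SameRegs σ σ') : Holds σ' as l := h.congr fun a ha => h'.2 a (h.le a ha)

/-- Compute the code of the word kept in the registers `as`. -/
def encProg {s : ℕ} : List ℤ → Program s
  | [] => .const (-1) 0
  | a :: as => .seq (encProg as) (.seq (.add (-1) (-1) (-1)) (.seq (.const (-3) 1)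
      (.seq (.add (-1) (-1) (-3)) (.seq (.const (-2) 0) (.seq (.add (-2) (-2) a)
        (.whilePos (-2) (.seq (.add (-1) (-1) (-1)) (.sub (-2) (-2) (-3)))))))))

/-- Codes are built from the last letter on by doubling and adding one, so addition suffices. They
are exponentially large, but an arithmetic operation is one step whatever its operands, so a letter
costs `O(n)`. -/
theorem exec_encProg {s : ℕ} (f : Fin s → Permutation → ℤ) (W n : ℕ) (σ : State s)
    (as : List ℤ) (l : List ℕ) (h : Holds σ as l) (hl : ∀ x ∈ l, x ≤ n) :
    Exec f W (encProg as) (as.length * (n * 3 + 6) + 1) σ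
      fun σ' => SameRegs σ σ' ∧ σ'.int (-1) = (enc l : ℤ) := by
  induction h with
  | nil => exact (Exec.const ⟨(SameRegs.refl σ).setInt (by norm_num), by simp [enc]⟩).le (by simp)
  | @cons a x as l hax _ ih =>
    have hx : x ≤ n := hl x (by simp)
    refine ((ih fun y hy => hl y (by simp [hy])).seq fun σ₁ h₁ =>
      Exec.seq (Exec.add rfl) fun σ₂ h₂ => Exec.seq (Exec.const rfl) fun σ₃ h₃ =>
      Exec.seq (Exec.add rfl) fun σ₄ h₄ => Exec.seq (Exec.const rfl) fun σ₅ h₅ =>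
      -- With `k` doublings left, cell `-1` times `2 ^ k` is the code already.
      Exec.seq (Exec.add rfl) fun σ₆ h₆ => (Exec.whilePos (T := 2) (fun k σ' => SameRegs σ σ' ∧
        σ'.int (-1) * 2 ^ k = (enc (x :: l) : ℤ) ∧ σ'.int (-2) = k ∧ σ'.int (-3) = 1)
        (fun k σ h => h.2.2.1) ?_ x σ₆ ?_).imp (fun σ' h' => ⟨h'.1, by simpa using h'.2.1⟩)).le ?_
    · rintro k σ₇ ⟨h1, h2, h3, h4⟩
      refine Exec.seq (T := 1) (Exec.add rfl) fun σ₈ h₈ => Exec.sub ?_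
      subst h₈
      refine ⟨(h1.setInt (by norm_num)).setInt (by norm_num), ?_, ?_, ?_⟩
      · simp only [State.setInt_int]; norm_num; rw [← h2, pow_succ]; ring
      · simp [h3, h4]
      · simp [h4]
    · subst h₂; subst h₃; subst h₄; subst h₅; subst h₆
      have ha : σ₁.int a = x := by rw [h₁.1.2 a hax.1, hax.2]
      have hne : a ≠ -2 ∧ a ≠ -1 ∧ a ≠ -3 := by have := hax.1; omega
      refine ⟨?_, ?_, ?_, ?_⟩
      · repeat' refine SameRegs.setInt ?_ (by norm_num)
        exact h₁.1
      · simp [h₁.2, enc]; ring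
      · simp [hne, ha]
      · simp
    · simp only [List.length_cons]
      have : (as.length + 1) * (n * 3 + 6) = as.length * (n * 3 + 6) + n * 3 + 6 := by ring
      omega

/-! ### Extending a word to a permutation -/

/-- The word `v`, followed by the remaining letters of `1, …, j` in increasing order. -/
def ext (j : ℕ) (v : List ℕ) : List ℕ := v ++ (List.range' 1 j).filter (· ∉ v)

/-- The word `u` is stored from address `0` on, and its length is in cell `-4`. -/
def ArrayHolds {s : ℕ} (σ : State s) (u : List ℕ) : Prop :=
  (∀ (i : ℕ) (h : i < u.length), σ.int i = (u[i] : ℤ)) ∧ σ.int (-4) = u.length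

theorem ArrayHolds.congr {s : ℕ} {σ σ' : State s} {u : List ℕ} (h : ArrayHolds σ u)
    (h' : ∀ a, 0 ≤ a ∨ a = -4 → σ'.int a = σ.int a) : ArrayHolds σ' u :=
  ⟨fun i hi => by rw [h' _ (Or.inl (by positivity)), h.1 i hi], by rw [h' _ (Or.inr rfl), h.2]⟩

/-- Append the letter in cell `r` to the stored word. -/
def appendProg {s : ℕ} (r : ℤ) : Program s := .seq (.store (-4) r) (.add (-4) (-4) (-3))

/-- The stored word starts at address `0`, so its length in cell `-4` is also the address of the
next free cell. All other bookkeeping has negative addresses and cannot collide with it. -/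
theorem exec_appendProg {s : ℕ} (f : Fin s → Permutation → ℤ) (W : ℕ) (σ : State s) (u : List ℕ)
    (c : ℕ) (r : ℤ) (hr : σ.int r = c) (hu : ArrayHolds σ u) (h3 : σ.int (-3) = 1) :
    Exec f W (appendProg r) 2 σ fun σ' => ArrayHolds σ' (u ++ [c]) ∧ σ'.poly = σ.poly ∧
      ∀ a < 0, a ≠ -4 → σ'.int a = σ.int a := by
  refine Exec.seq (T := 1) (Exec.store rfl) fun σ₁ h₁ => Exec.add ?_
  subst h₁
  rw [hu.2, hr]
  have hne : ∀ i : ℕ, (i : ℤ) ≠ -4 := fun i => by omega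
  refine ⟨⟨fun i hi => ?_, ?_⟩, rfl, fun a ha ha4 => ?_⟩
  · simp only [List.length_append, List.length_singleton] at hi
    simp only [State.setInt_int, hne, if_false, Nat.cast_inj]
    split_ifs with h
    · subst h; simp
    · rw [hu.1 i (by omega), List.getElem_append_left (by omega)]
  · have : ∀ i : ℕ, (-4 : ℤ) ≠ i := fun i => (hne i).symm
    have : ∀ i : ℕ, (-3 : ℤ) ≠ i := fun i => by omega
    simp [hu.2, *]
  · simp [ha4, show a ≠ (u.length : ℤ) by omega]

/-- Append the letters in the registers `as` to the stored word. -/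
def storeProg {s : ℕ} : List ℤ → Program s
  | [] => .skip
  | a :: as => .seq (appendProg a) (storeProg as)

theorem exec_storeProg {s : ℕ} (f : Fin s → Permutation → ℤ) (W : ℕ) (as : List ℤ) (l : List ℕ)
    (σ : State s) (h : Holds σ as l) (u : List ℕ) (hu : ArrayHolds σ u) (h3 : σ.int (-3) = 1) :
    Exec f W (storeProg as) (as.length * 2 + 1) σ fun σ' => ArrayHolds σ' (u ++ l) ∧
      SameRegs σ σ' ∧ σ'.int (-3) = 1 := by
  induction as generalizing σ l u with
  | nil =>
    cases h
    exact (Exec.skip ⟨by simpa using hu, SameRegs.refl _, h3⟩).le (by simp)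
  | cons a as ih =>
    obtain - | ⟨hax, hl⟩ := h
    rename_i x l
    refine ((exec_appendProg f W σ u x a hax.2 hu h3).seq fun σ₁ h₁ =>
      (ih l σ₁ ?_ (u ++ [x]) h₁.1 ?_).imp fun σ₂ h₂ => ⟨by simpa using h₂.1, ?_, h₂.2.2⟩).le
        (by simp; omega)
    · exact Holds.congr (σ := σ) hl fun b hb =>
        h₁.2.2 b (by have := Holds.le hl b hb; omega) (by have := Holds.le hl b hb; omega)
    · rw [h₁.2.2 _ (by norm_num) (by norm_num), h3]
    · exact SameRegs.trans ⟨h₁.2.1, fun b hb => h₁.2.2 b (by omega) (by omega)⟩ h₂.2.1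

/-- Run `P` if the number in cell `-5` is in none of the registers `as`. -/
def notMemProg {s : ℕ} (P : Program s) : List ℤ → Program s
  | [] => P
  | a :: as => .seq (.sub (-7) (-5) a) (.ifPos (-7) (notMemProg P as)
      (.seq (.sub (-7) a (-5)) (.ifPos (-7) (notMemProg P as) .skip)))

/-- Only positivity can be tested: two numbers are equal when neither difference is positive. Every
comparison duplicates the remaining program, but the number of registers is fixed and a run enters
only one copy. -/
theorem exec_notMemProg {s : ℕ} (f : Fin s → Permutation → ℤ) (W T : ℕ) (P : Program s)
    (Q : State s → Prop) (c : ℕ) (as : List ℤ) (l : List ℕ) (σ : State s) (h : Holds σ as l)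
    (hc : σ.int (-5) = c)
    (h₁ : c ∉ l → ∀ σ' : State s, σ'.poly = σ.poly → (∀ a ≠ -7, σ'.int a = σ.int a) →
      Exec f W P T σ' Q)
    (h₂ : c ∈ l → ∀ σ' : State s, σ'.poly = σ.poly → (∀ a ≠ -7, σ'.int a = σ.int a) → Q σ') :
    Exec f W (notMemProg P as) (as.length * 4 + 1 + T) σ Q := by
  induction as generalizing σ l with
  | nil =>
    cases h
    exact (h₁ (by simp) σ rfl fun _ _ => rfl).le (by omega)
  | cons a as ih =>
    obtain - | ⟨hax, hl⟩ := h
    rename_i x l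
    have ha7 : a ≠ -7 := by have := hax.1; omega
    have key : ∀ σ' : State s, σ'.poly = σ.poly → (∀ a ≠ -7, σ'.int a = σ.int a) → c ≠ x →
        Exec f W (notMemProg P as) (as.length * 4 + 1 + T) σ' Q := by
      intro σ' hp hi hne
      refine ih l σ' (Holds.congr (σ := σ) hl fun b hb =>
        hi b (by have := Holds.le hl b hb; omega)) (by rw [hi _ (by norm_num), hc]) ?_ ?_
      · intro hcl σ'' hp' hi'
        exact h₁ (by simp [hne, hcl]) σ'' (hp'.trans hp) fun b hb => (hi' b hb).trans (hi b hb)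
      · intro hcl σ'' hp' hi'
        exact h₂ (by simp [hcl]) σ'' (hp'.trans hp) fun b hb => (hi' b hb).trans (hi b hb)
    refine (Exec.seq (T := 1) (Exec.sub rfl) fun σ₁ e₁ => Exec.ifPos
      (T := 1 + (1 + (as.length * 4 + 1 + T))) (fun hpos => ?_)
      fun hneg => Exec.seq (T := 1) (Exec.sub rfl) fun σ₂ e₂ => Exec.ifPos (fun hpos => ?_)
        fun hneg' => ?_).le (by simp; omega)
    · subst e₁
      simp [hc, hax.2] at hpos
      exact Exec.le (key _ (by rfl) (fun b hb => by simp [hb]) (by omega)) (by omega)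
    · subst e₂; subst e₁
      simp [hc, hax.2, ha7] at hpos
      exact key _ rfl (fun b hb => by simp [hb]) (by omega)
    · subst e₂; subst e₁
      simp [hc, hax.2, ha7] at hneg hneg'
      have : c = x := by omega
      exact Exec.le (Exec.skip (h₂ (by simp [this]) _ (by rfl) fun b hb => by simp [hb])) (by omega)

/-- Store the permutation `ext j v`, where `j` is kept in register `a` and `v` in `as`. -/
def extProg {s : ℕ} (a : ℤ) (as : List ℤ) : Program s :=
  .seq (.const (-4) 0) (.seq (.const (-3) 1) (.seq (storeProg as)
    (forLoop (-5) a 0 (notMemProg (appendProg (-5)) as))))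

theorem exec_extProg {s : ℕ} (f : Fin s → Permutation → ℤ) (W : ℕ) (σ : State s) (a : ℤ)
    (as : List ℤ) (j : ℕ) (v : List ℕ) (h : Holds σ (a :: as) (j :: v)) :
    Exec f W (extProg a as) (as.length * 2 + 6 + j * (as.length * 4 + 7)) σ
      fun σ' => ArrayHolds σ' (ext j v) ∧ SameRegs σ σ' := by
  obtain - | ⟨⟨ha, haj⟩, hv⟩ := h
  refine (Exec.seq (T := 1) (Exec.const rfl) fun σ₁ e₁ => Exec.seq (T := 1) (Exec.const rfl)
    fun σ₂ e₂ => Exec.seq (exec_storeProg f W as v σ₂ (Holds.of_same hv ?_) [] ?_ ?_)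
    fun σ₃ h₃ => (Exec.forLoop (T := as.length * 4 + 3) (a := 0) (b := j)
      (fun k σ' => ArrayHolds σ' (v ++ (List.range' 1 k).filter (· ∉ v)) ∧ SameRegs σ σ' ∧
        σ'.int (-5) = k) (by norm_num) (by omega) ?_ ?_ ?_ ?_ ?_).imp
          fun σ₄ h₄ => ?_).le (Nat.le_of_eq ?_)
  · subst e₂; subst e₁
    exact (((SameRegs.refl σ).setInt (by norm_num))).setInt (by norm_num)
  · subst e₂; subst e₁
    exact ⟨by simp, by simp⟩
  · subst e₂; simp
  · subst e₂; subst e₁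
    rw [h₃.2.1.2 a ha]
    simp [show a ≠ -3 ∧ a ≠ -4 by omega, haj]
  · rintro k σ' ⟨-, h2, h3⟩
    exact ⟨h3, by rw [h2.2 a ha, haj]⟩
  · rintro k σ' c ⟨h1, h2, h3⟩
    refine ⟨h1.congr fun b hb => ?_, h2.setInt (by norm_num), by simp [h3]⟩
    simp [show b ≠ -9 by omega]
  · rintro k σ' - hk ⟨h1, h2, h3⟩
    have hs : SameRegs σ ((σ'.setInt (-3) 1).setInt (-5) (k + 1 : ℕ)) :=
      (h2.setInt (by norm_num)).setInt (by norm_num)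
    have hA : ArrayHolds ((σ'.setInt (-3) 1).setInt (-5) (k + 1 : ℕ))
        (v ++ (List.range' 1 k).filter (· ∉ v)) := h1.congr fun b hb => by
      simp [show b ≠ -5 ∧ b ≠ -3 by omega]
    refine exec_notMemProg f W 2 _ _ (k + 1) as v _ (Holds.of_same hv hs) (by simp) ?_ ?_
    · intro hkv σ'' hp hi
      refine (exec_appendProg f W σ'' _ (k + 1) (-5) (by rw [hi _ (by norm_num)]; simp)
        (hA.congr fun b hb => hi b (by omega)) (by rw [hi _ (by norm_num)]; simp)).imp ?_
      rintro σ₅ ⟨h5, h6, h7⟩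
      refine ⟨?_, hs.trans ⟨h6.trans hp, fun b hb => ?_⟩, ?_⟩
      · rw [List.append_assoc] at h5
        rw [List.range'_concat, List.filter_append]
        simpa [add_comm 1 k, hkv] using h5
      · rw [h7 b (by omega) (by omega), hi b (by omega)]
      · rw [h7 _ (by norm_num) (by norm_num), hi _ (by norm_num)]; simp
    · intro hkv σ'' hp hi
      refine ⟨?_, hs.trans ⟨hp, fun b hb => hi b (by omega)⟩, ?_⟩
      · rw [List.range'_concat, List.filter_append]
        simpa [add_comm 1 k, hkv] using hA.congr fun b hb => hi b (by omega)
      · rw [hi _ (by norm_num)]; simp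
  · subst e₂; subst e₁
    refine ⟨?_, ?_, by simp⟩
    · simpa using h₃.1.congr (σ' := σ₃.setInt (-5) 0) fun b hb => by simp [show b ≠ -5 by omega]
    · refine SameRegs.setInt (SameRegs.trans ?_ h₃.2.1) (by norm_num)
      exact (((SameRegs.refl σ).setInt (by norm_num))).setInt (by norm_num)
  · rw [Nat.zero_max] at h₄
    exact ⟨h₄.1, h₄.2.1⟩
  · simp; ring

/-! ### Evaluating the statistics -/

/-- Evaluate the statistics with indices in `is` at the stored permutation, whose length is in
cell `a`, and keep the values in the registers `E i`. -/
def queryProg {s : ℕ} (a : ℤ) (E : Fin s → ℤ) : List (Fin s) → Program s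
  | [] => .skip
  | i :: is => .seq (.const (-6) 0) (.seq (.query (E i) i (-6) a) (queryProg a E is))

theorem exec_queryProg {s : ℕ} (f : Fin s → Permutation → ℤ) (W : ℕ) (a : ℤ) (E : Fin s → ℤ)
    (hE : ∀ i, E i ≤ -10) (hEa : ∀ i, E i ≠ a) (ha : a ≤ -10)
    (is : List (Fin s)) (his : is.Nodup) (hEi : Function.Injective E) (π : Permutation)
    (σ : State s) (hπ : ArrayHolds σ π.1) (hj : σ.int a = π.length) :
    Exec f W (queryProg a E is) (is.length * (π.length + 2) + 1) σ fun σ' =>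
      σ'.poly = σ.poly ∧ (∀ i ∈ is, σ'.int (E i) = f i π) ∧
      ∀ b ≤ -10, (∀ i ∈ is, b ≠ E i) → σ'.int b = σ.int b := by
  induction is generalizing σ with
  | nil => exact (Exec.skip ⟨rfl, by simp, fun _ _ _ => rfl⟩).le (by simp)
  | cons i is ih =>
    rw [List.nodup_cons] at his
    refine (Exec.seq (T := 1) (Exec.const rfl) fun σ₁ e₁ => Exec.seq (T := 1 + π.length)
      (Exec.query (π := π) ?_ ?_ rfl) fun σ₂ e₂ => (ih his.2 σ₂ ?_ ?_).imp fun σ₃ h₃ => ?_).le ?_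
    · subst e₁; simp [show a ≠ -6 by omega, hj]
    · subst e₁
      intro k
      have : (k : ℤ) ≠ -6 := by omega
      simp only [State.setInt_int, if_true, zero_add, this, if_false]
      exact hπ.1 k k.2
    · subst e₂; subst e₁
      have := hE i
      exact hπ.congr fun b hb => by simp [show b ≠ -6 by omega, show b ≠ E i by omega]
    · subst e₂; subst e₁
      simp [(hEa i).symm, show a ≠ -6 by omega, hj]
    · subst e₂; subst e₁
      refine ⟨h₃.1, fun k hk => ?_, fun b hb hbE => ?_⟩
      · rcases List.mem_cons.1 hk with rfl | hk
        · rw [h₃.2.2 _ (hE k) (fun k' hk' h => his.1 (hEi h ▸ hk'))]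
          simp
        · exact h₃.2.1 k hk
      · rw [h₃.2.2 b hb fun k hk => hbE k (by simp [hk])]
        simp [hbE i (by simp), show b ≠ -6 by omega]
    · simp only [List.length_cons]
      have : (is.length + 1) * (π.length + 2) = is.length * (π.length + 2) + π.length + 2 := by ring
      omega

/-! ### Avoiders, cylinders and distributions -/

theorem mem_avoiders {n : ℕ} {B : Set VincularPattern} {π : Permutation} :
    π ∈ avoiders n B ↔ π.length = n ∧ ∀ τ ∈ B, ¬ Contains π τ := by
  simp only [avoiders, Finset.mem_filter, Finset.mem_subtype, List.mem_toFinset,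
    List.mem_permutations]
  refine and_congr_left fun _ => ⟨fun h => by simpa [Permutation.length] using h.length_eq, fun h => ?_⟩
  have := π.2
  rw [IsPermutation, show π.1.length = n from h] at this
  exact this

/-- The permutations `π ∈ S_j(B)` that begin with `v`. -/
noncomputable def cylinder (B : Set VincularPattern) (j : ℕ) (v : List ℕ) : Finset Permutation :=
  (avoiders j B).filter fun π => π.1.take v.length = v

theorem cylinder_subset (B : Set VincularPattern) (j : ℕ) (v : List ℕ) :
    cylinder B j v ⊆ avoiders j B := Finset.filter_subset _ _

/-- An exponent with nonzero coefficient must be the value of `f` at some element of `S`. -/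
theorem terms_distribution_le {s : ℕ} (S : Finset Permutation) (f : Fin s → Permutation → ℤ) :
    terms (distribution S f) ≤ (S.image fun π i => f i π).card := by
  refine Finset.card_le_card fun e he => ?_
  rw [Finsupp.mem_support_iff] at he
  by_contra hne
  refine he ?_
  have : (AddMonoidAlgebra.coeff (distribution S f)) =
      ∑ π ∈ S, AddMonoidAlgebra.coeff (monomial fun i => f i π) := by
    unfold distribution
    exact map_sum (AddMonoidAlgebra.coeffAddEquiv (R := ℤ) (M := Fin s → ℤ)) _ _
  rw [this, Finsupp.finsetSum_apply]
  refine Finset.sum_eq_zero fun π hπ => ?_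
  simp only [monomial, AddMonoidAlgebra.coeff_single]
  refine Finsupp.single_eq_of_ne fun h => hne ?_
  exact Finset.mem_image.2 ⟨π, hπ, h.symm⟩

theorem terms_le_maxValues {s : ℕ} (B : Set VincularPattern) (f : Fin s → Permutation → ℤ)
    {i n : ℕ} (hi : i ≤ n) {S : Finset Permutation} (hS : S ⊆ avoiders i B) :
    terms (distribution S f) ≤ maxValues B f n :=
  (terms_distribution_le S f).trans <| (Finset.card_le_card (Finset.image_subset_image hS)).trans <|
    Finset.le_sup (f := fun j => ((avoiders j B).image fun π i => f i π).card)
      (Finset.mem_range.2 (Nat.lt_succ_of_le hi))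

/-- The program enters all avoiders shorter than `L` even if `n < L`. The lengths above `n` that
matter are at most `L`, and there the number of values is at most the number of avoiders, which does
not depend on `f`. -/
theorem maxValues_max_le {s : ℕ} (B : Set VincularPattern) (f : Fin s → Permutation → ℤ)
    (n L : ℕ) : maxValues B f (max n L) ≤
      (∑ j ∈ Finset.range (L + 1), (avoiders j B).card) + maxValues B f n := by
  refine Finset.sup_le fun j hj => ?_
  rw [Finset.mem_range] at hj
  by_cases hjn : j ≤ n
  · refine le_add_left (Finset.le_sup
      (f := fun j => ((avoiders j B).image fun π i => f i π).card) (Finset.mem_range.2 ?_))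
    omega
  · refine le_add_right (Finset.card_image_le.trans ?_)
    exact Finset.single_le_sum (f := fun j => (avoiders j B).card) (fun _ _ => Nat.zero_le _)
      (Finset.mem_range.2 (by omega))

/-- The letters of `v` are distinct numbers in `1, …, j`. -/
def IsInjWord (j : ℕ) (v : List ℕ) : Prop := v.Nodup ∧ ∀ x ∈ v, 1 ≤ x ∧ x ≤ j

theorem ext_perm {j : ℕ} {v : List ℕ} (h : IsInjWord j v) :
    (ext j v).Perm (List.range' 1 j) := by
  have h1 : ((List.range' 1 j).filter (· ∈ v)).Perm v := by
    refine (List.perm_ext_iff_of_nodup ((List.nodup_range' (step := 1)).filter _) h.1).2 fun x => ?_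
    have := h.2 x
    simp only [List.mem_filter, List.mem_range'_1, decide_eq_true_eq, and_iff_right_iff_imp]
    intro hx
    have := this hx
    omega
  have h2 := List.filter_append_perm (fun x => decide (x ∈ v)) (List.range' 1 j)
  refine List.Perm.trans ?_ h2
  unfold ext
  simp only [decide_not]
  exact List.Perm.append_right _ h1.symm

/-- The permutation `ext j v`. -/
def extPerm (j : ℕ) (v : List ℕ) (h : IsInjWord j v) : Permutation :=
  ⟨ext j v, by
    have h1 := ext_perm h
    have h2 : (ext j v).length = j := by simpa using h1.length_eq
    unfold IsPermutation
    rwa [h2]⟩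

theorem length_extPerm {j : ℕ} {v : List ℕ} (h : IsInjWord j v) : (extPerm j v h).length = j := by
  simpa [Permutation.length, extPerm] using (ext_perm h).length_eq

theorem Permutation.isInjWord (π : Permutation) : IsInjWord π.length π.1 := by
  refine ⟨π.2.nodup, fun x hx => ?_⟩
  have := (List.Perm.mem_iff π.2).1 hx
  rw [List.mem_range'_1] at this
  have hl : π.length = π.1.length := rfl
  omega

theorem extPerm_self (π : Permutation) : extPerm π.length π.1 π.isInjWord = π := by
  apply Subtype.ext
  change ext π.length π.1 = π.1
  have : (List.range' 1 π.length).filter (· ∉ π.1) = [] := by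
    rw [List.filter_eq_nil_iff]
    intro x hx
    have := (List.Perm.mem_iff π.2).2 hx
    simpa using this
  rw [ext, this, List.append_nil]

/-! ### Words in families of registers -/

/-- The first `k` registers of the family `A`. -/
def regs (A : ℕ → ℤ) (k : ℕ) : List ℤ := (List.range k).map A

theorem length_regs (A : ℕ → ℤ) (k : ℕ) : (regs A k).length = k := by simp [regs]

theorem regs_succ (A : ℕ → ℤ) (k : ℕ) : regs A (k + 1) = A 0 :: regs (fun i => A (i + 1)) k := by
  simp [regs, List.range_succ_eq_map, Function.comp_def]

theorem holds_regs {s : ℕ} {σ : State s} {A : ℕ → ℤ} (hA : ∀ i, A i ≤ -10) {l : List ℕ} :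
    Holds σ (regs A l.length) l ↔ ∀ (i : ℕ) (h : i < l.length), σ.int (A i) = (l[i] : ℤ) := by
  rw [Holds, List.forall₂_iff_get]
  simp [regs, hA]

theorem holds_regs_take {s : ℕ} {σ : State s} {A : ℕ → ℤ} (hA : ∀ i, A i ≤ -10) {l : List ℕ}
    (h : Holds σ (regs A l.length) l) {k : ℕ} (hk : k ≤ l.length) :
    Holds σ (regs A k) (l.take k) := by
  have hl : (l.take k).length = k := by simp [hk]
  rw [holds_regs hA] at h
  have := (holds_regs (σ := σ) hA (l := l.take k)).2 fun i hi => by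
    rw [h i (by rw [hl] at hi; omega)]; simp
  rwa [hl] at this

/-- Registers of the current word: `j`, followed by the letters of `v`. -/
def regV (i : ℕ) : ℤ := -(20 + 4 * i)

/-- Registers of the word after deletion. -/
def regV' (i : ℕ) : ℤ := -(21 + 4 * i)

/-- Registers of the values of the statistics. -/
def regE {s : ℕ} (i : Fin s) : ℤ := -(22 + 4 * (i : ℕ))

/-- Registers of the values of the statistics after deletion. -/
def regE' {s : ℕ} (i : Fin s) : ℤ := -(23 + 4 * (i : ℕ))

theorem regV_le (i : ℕ) : regV i ≤ -10 := by unfold regV; omega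

theorem regV'_le (i : ℕ) : regV' i ≤ -10 := by unfold regV'; omega

theorem regE_le {s : ℕ} (i : Fin s) : regE i ≤ -10 := by unfold regE; omega

theorem regE'_le {s : ℕ} (i : Fin s) : regE' i ≤ -10 := by unfold regE'; omega

theorem regE_injective {s : ℕ} : Function.Injective (regE (s := s)) := fun i j h => by
  unfold regE at h; ext; omega

theorem regE'_injective {s : ℕ} : Function.Injective (regE' (s := s)) := fun i j h => by
  unfold regE' at h; ext; omega

/-! ### Values of the statistics at the standard extension of a word -/

/-- Evaluate all statistics at `ext j v`, where `j :: v` is kept in the first registers of the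
family `A`, and `|v| = k`. -/
def statProg {s : ℕ} (A : ℕ → ℤ) (k : ℕ) (E : Fin s → ℤ) : Program s :=
  .seq (extProg (A 0) (regs (fun i => A (i + 1)) k)) (queryProg (A 0) E (List.finRange s))

/-- A bound on the running time of `statProg`. -/
def statTime (s k n : ℕ) : ℕ := (k * 2 + 6 + n * (k * 4 + 7)) + (s * (n + 2) + 1)

theorem exec_statProg {s : ℕ} (f : Fin s → Permutation → ℤ) (W : ℕ) (σ : State s) (A : ℕ → ℤ)
    (E : Fin s → ℤ) (hA : ∀ i, A i ≤ -10) (hE : ∀ i, E i ≤ -10) (hEA : ∀ i, E i ≠ A 0)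
    (hEi : Function.Injective E) {j n L : ℕ} {v : List ℕ} (hv : IsInjWord j v) (hj : j ≤ n)
    (hL : v.length ≤ L) (h : Holds σ (regs A (v.length + 1)) (j :: v)) :
    Exec f W (statProg A v.length E) (statTime s L n) σ fun σ' =>
      σ'.poly = σ.poly ∧ (∀ i, σ'.int (E i) = f i (extPerm j v hv)) ∧
      ∀ b ≤ -10, (∀ i, b ≠ E i) → σ'.int b = σ.int b := by
  have hlen := length_extPerm hv
  rw [regs_succ] at h
  have hA0 : σ.int (A 0) = j := by cases h with | cons h _ => exact h.2
  refine ((exec_extProg f W σ _ _ j v h).seq fun σ₁ h₁ =>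
    (exec_queryProg f W (A 0) E hE hEA (hA 0) (List.finRange s) (List.nodup_finRange s) hEi
      (extPerm j v hv) σ₁ h₁.1 ?_).imp fun σ₂ h₂ =>
        ⟨h₂.1.trans h₁.2.1, fun i => h₂.2.1 i (List.mem_finRange i), fun b hb hbE => ?_⟩).le ?_
  · rw [h₁.2.2 _ (hA 0), hA0, hlen]
  · rw [length_regs, hlen, List.length_finRange]
    unfold statTime
    gcongr
  · rw [h₂.2.2 b hb fun i _ => hbE i, h₁.2.2 b hb]

/-! ### Adding a polynomial to the cells of all prefixes -/

/-- Add the polynomial in cell `-1` to the cells of the words `j :: u`, where `u` is a prefix of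
`v` of length at most `k`. -/
def commitProg {s : ℕ} : ℕ → Program s
  | 0 => .seq (encProg (regs regV 1)) (.seq (.const (-8) (-1)) (.polyAdd (-1) (-1) (-8)))
  | k + 1 => .seq (commitProg k) (.seq (encProg (regs regV (k + 2)))
      (.seq (.const (-8) (-1)) (.polyAdd (-1) (-1) (-8))))

theorem exec_addPrefix {s : ℕ} (f : Fin s → Permutation → ℤ) {W n L j k : ℕ} {v : List ℕ}
    {σ : State s} (h : Holds σ (regs regV (v.length + 1)) (j :: v))
    (hn : ∀ x ∈ j :: v, x ≤ n) (hX : terms (σ.poly (-1)) ≤ W)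
    (hW : terms (σ.poly (enc (j :: v.take k))) ≤ W) (hk : k ≤ v.length) (hL : v.length ≤ L) :
    Exec f W (.seq (encProg (regs regV (k + 1))) (.seq (.const (-8) (-1))
        (.polyAdd (-1) (-1) (-8)))) ((L + 1) * (n * 3 + 6) + 3) σ fun σ' =>
      (∀ a, σ'.poly a = σ.poly a + if a = enc (j :: v.take k) then σ.poly (-1) else 0) ∧
      ∀ a ≤ -10, σ'.int a = σ.int a := by
  have hh : Holds σ (regs regV (k + 1)) (j :: v.take k) := by
    have := holds_regs_take (k := k + 1) regV_le (l := j :: v) (σ := σ) (by simpa using h)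
      (by simpa using hk)
    simpa using this
  refine ((exec_encProg f W n σ _ _ hh fun x hx => hn x ?_).seq fun σ₁ h₁ =>
    Exec.seq (T := 1) (Exec.const rfl) fun σ₂ e₂ => Exec.polyAdd ?_ ?_ ?_).le ?_
  · rcases List.mem_cons.1 hx with rfl | hx
    · simp
    · exact List.mem_cons_of_mem _ (List.mem_of_mem_take hx)
  · subst e₂
    simpa [h₁.2, h₁.1.1] using hW
  · subst e₂
    simpa [h₁.1.1] using hX
  · subst e₂
    refine ⟨fun a => ?_, fun a ha => ?_⟩
    · simp only [State.setInt_int, State.setInt_poly, State.setPoly_poly]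
      norm_num
      rw [h₁.2, h₁.1.1]
      split_ifs with h
      · rw [h]
      · simp
    · simp [show a ≠ -8 by omega, h₁.1.2 a ha]
  · rw [length_regs]
    have : (k + 1) * (n * 3 + 6) ≤ (L + 1) * (n * 3 + 6) := by gcongr; omega
    omega

theorem enc_take_inj {j k l : ℕ} {v : List ℕ} (hk : k ≤ v.length) (hl : l ≤ v.length)
    (h : enc (j :: v.take k) = enc (j :: v.take l)) : k = l := by
  have := congrArg List.length (enc_injective h)
  simpa [hk, hl] using this

/-- Codes are nonnegative, so the summand in cell `-1` survives all additions; different prefixes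
have different codes, so each of their cells receives it once. -/
theorem exec_commitProg {s : ℕ} (f : Fin s → Permutation → ℤ) {W n L j : ℕ} {v : List ℕ}
    (hn : ∀ x ∈ j :: v, x ≤ n) (hL : v.length ≤ L) {σ : State s}
    (h : Holds σ (regs regV (v.length + 1)) (j :: v)) (hX : terms (σ.poly (-1)) ≤ W)
    (hW : ∀ k ≤ v.length, terms (σ.poly (enc (j :: v.take k))) ≤ W) (k : ℕ) (hk : k ≤ v.length) :
    Exec f W (commitProg k) ((k + 1) * ((L + 1) * (n * 3 + 6) + 3)) σ fun σ' =>
      (∀ a, σ'.poly a = σ.poly a +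
        if ∃ l ≤ k, a = enc (j :: v.take l) then σ.poly (-1) else 0) ∧
      ∀ a ≤ -10, σ'.int a = σ.int a := by
  induction k with
  | zero =>
    refine ((exec_addPrefix f h hn hX (hW 0 hk) hk hL).imp fun σ' h' => ⟨fun a => ?_, h'.2⟩).le
      (by simp)
    rw [h'.1 a]
    congr 1
    exact if_congr (by simp) rfl rfl
  | succ k ih =>
    have hneg : ∀ l, ¬ (-1 : ℤ) = enc (j :: v.take l) := fun l => by omega
    refine ((ih (by omega)).seq fun σ₁ h₁ => (exec_addPrefix f (k := k + 1) (L := L) (n := n)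
      (h.congr fun a ha => h₁.2 a (h.le a ha)) hn ?_ ?_ hk hL).imp
        fun σ₂ h₂ => ⟨fun a => ?_, fun a ha => (h₂.2 a ha).trans (h₁.2 a ha)⟩).le
          (Nat.le_of_eq (by ring))
    · rw [h₁.1]
      simpa [hneg] using hX
    · rw [h₁.1, if_neg, add_zero]
      · exact hW _ hk
      · rintro ⟨l, hl, he⟩
        have := enc_take_inj hk (by omega) (Nat.cast_injective he)
        omega
    · rw [h₂.1, h₁.1, h₁.1 (-1)]
      simp only [hneg, and_false, exists_false, if_false, add_zero]
      by_cases h1 : ∃ l ≤ k, a = enc (j :: v.take l)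
      · have h2 : a ≠ enc (j :: v.take (k + 1)) := by
          obtain ⟨l, hl, he⟩ := h1
          intro h2
          have := enc_take_inj hk (by omega) (Nat.cast_injective (h2.symm.trans he))
          omega
        have h3 : ∃ l ≤ k + 1, a = enc (j :: v.take l) :=
          let ⟨l, hl, he⟩ := h1; ⟨l, by omega, he⟩
        simp [h1, h2, h3]
      · by_cases h2 : a = enc (j :: v.take (k + 1))
        · have h3 : ∃ l ≤ k + 1, a = enc (j :: v.take l) := ⟨_, le_rfl, h2⟩
          rw [if_neg h1, if_pos h2, if_pos h3, add_zero]
        · have h3 : ¬ ∃ l ≤ k + 1, a = enc (j :: v.take l) := by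
            rintro ⟨l, hl, he⟩
            rcases Nat.lt_or_ge k l with h | h
            · exact h2 (by rw [he, show l = k + 1 by omega])
            · exact h1 ⟨l, h, he⟩
          simp [h1, h2, h3]

/-! ### The table of distributions -/

/-- The polynomial memory `p` records the distributions over the sets of those permutations in
`D` that belong to `S_i(B)` and begin with `u`, for all `i` and all `u` of length at most `L`. -/
def Table {s : ℕ} (B : Set VincularPattern) (f : Fin s → Permutation → ℤ) (L : ℕ)
    (D : Set Permutation) (p : ℤ → Laurent s) : Prop :=
  open Classical in
  p 0 = 0 ∧ ∀ (i : ℕ) (u : List ℕ), u.length ≤ L →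
    p (enc (i :: u)) = distribution ((cylinder B i u).filter (· ∈ D)) f

section Table

variable {s : ℕ} {B : Set VincularPattern} {f : Fin s → Permutation → ℤ} {L : ℕ}

theorem Table.congr {D D' : Set Permutation} {p : ℤ → Laurent s} (h : Table B f L D p)
    (hD : ∀ π, (∀ τ ∈ B, ¬ Contains π τ) → (π ∈ D ↔ π ∈ D')) : Table B f L D' p := by
  classical
  refine ⟨h.1, fun i u hu => ?_⟩
  rw [h.2 i u hu]
  congr 1
  refine Finset.filter_congr fun π hπ => hD π ?_
  exact (mem_avoiders.1 (cylinder_subset _ _ _ hπ)).2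

/-- If a permutation of length `j` begins with both `u` and `v`, and `|u| ≤ L`, then `u` is a prefix
of `v` provided that `|v| = L` or `v` is the whole permutation; this is the role of `hv`. So the new
permutations affect the cells of prefixes of `v` only, and by `hD` none is counted twice. -/
theorem Table.insert {D : Set Permutation} {p p' : ℤ → Laurent s} (h : Table B f L D p)
    {j : ℕ} {v : List ℕ} (hv : v.length = L ∨ v.length = j)
    (hD : ∀ π ∈ D, ¬ (π.length = j ∧ π.1.take v.length = v))
    (hp' : ∀ a : ℤ, p' a = p a + if ∃ l ≤ v.length, a = enc (j :: v.take l) then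
      distribution (cylinder B j v) f else 0) :
    Table B f L (D ∪ {π | π.length = j ∧ π.1.take v.length = v}) p' := by
  classical
  refine ⟨?_, fun i u hu => ?_⟩
  -- Cell `0` is the code of the empty word, which is not of the form `i :: u`; it stays zero until
  -- the output is written there.
  · rw [hp', h.1, if_neg, add_zero]
    rintro ⟨l, -, hl⟩
    have := enc_cons_pos j (v.take l)
    omega
  rw [hp', h.2 i u hu]
  by_cases hc : ∃ l ≤ v.length, (enc (i :: u) : ℤ) = enc (j :: v.take l)
  · rw [if_pos hc]
    obtain ⟨l, hl, he⟩ := hc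
    have he' := enc_injective (Nat.cast_injective he)
    obtain ⟨rfl, rfl⟩ := List.cons.inj he'
    unfold distribution
    rw [← Finset.sum_union]
    · congr 1
      ext π
      simp only [cylinder, Finset.mem_union, Finset.mem_filter, Set.mem_union, Set.mem_ofPred_eq]
      constructor
      · rintro (⟨h1, h2⟩ | ⟨h1, h2⟩)
        · exact ⟨h1, Or.inl h2⟩
        · refine ⟨⟨h1, ?_⟩, Or.inr ⟨(mem_avoiders.1 h1).1, h2⟩⟩
          rw [List.length_take, min_eq_left hl]
          conv_rhs => rw [← h2]
          rw [List.take_take, min_eq_left hl]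
      · rintro ⟨h1, h2 | h2⟩
        · exact Or.inl ⟨h1, h2⟩
        · exact Or.inr ⟨h1.1, h2.2⟩
    · rw [Finset.disjoint_left]
      intro π h1 h2
      simp only [cylinder, Finset.mem_filter] at h1 h2
      exact hD π h1.2 ⟨(mem_avoiders.1 h2.1).1, h2.2⟩
  · rw [if_neg hc, add_zero]
    congr 1
    ext π
    simp only [Finset.mem_filter, Set.mem_union, Set.mem_ofPred_eq]
    refine and_congr_right fun hπ => ⟨Or.inl, fun h => h.resolve_right ?_⟩
    rintro ⟨h1, h2⟩
    simp only [cylinder, Finset.mem_filter, mem_avoiders] at hπ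
    obtain ⟨⟨h3, -⟩, h4⟩ := hπ
    refine hc ⟨u.length, ?_, ?_⟩
    · rcases hv with hv | hv
      · omega
      · have := congrArg List.length h4
        have hl : π.length = π.1.length := rfl
        rw [List.length_take] at this
        omega
    · have hul : u.length ≤ v.length := by
        rcases hv with hv | hv
        · omega
        · have := congrArg List.length h4
          have hl : π.length = π.1.length := rfl
          rw [List.length_take] at this
          omega
      rw [← h3, h1, ← h2, List.take_take, min_eq_left hul, h4]

theorem Table.insert_empty {D : Set Permutation} {p : ℤ → Laurent s} (h : Table B f L D p)
    {j : ℕ} {v : List ℕ} (hv : cylinder B j v = ∅) :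
    Table B f L (D ∪ {π | π.length = j ∧ π.1.take v.length = v}) p := by
  refine h.congr fun π hπ => ⟨Or.inl, fun h => h.resolve_right fun hc => ?_⟩
  have : π ∈ cylinder B j v := by
    simp only [cylinder, Finset.mem_filter, mem_avoiders]
    exact ⟨⟨hc.1, hπ⟩, hc.2⟩
  simp [hv] at this

theorem Table.terms_le {D : Set Permutation} {p : ℤ → Laurent s} (h : Table B f L D p)
    {i n : ℕ} (hi : i ≤ n) {u : List ℕ} (hu : u.length ≤ L) :
    terms (p (enc (i :: u))) ≤ maxValues B f n := by
  classical
  rw [h.2 i u hu]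
  exact terms_le_maxValues B f hi ((Finset.filter_subset _ _).trans (cylinder_subset _ _ _))

/-- The summand is prepared at a negative address, which the table does not see; hence agreement
with `σ₀` on nonnegative addresses is enough. -/
theorem exec_commit_table {n j : ℕ} {v : List ℕ} {D : Set Permutation} {σ₀ σ : State s}
    (hn : j ≤ n) (hinj : IsInjWord j v) (hL : v.length ≤ L) (hv : v.length = L ∨ v.length = j)
    (h : Holds σ (regs regV (v.length + 1)) (j :: v)) (hT : Table B f L D σ₀.poly)
    (hp : ∀ a : ℤ, 0 ≤ a → σ.poly a = σ₀.poly a)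
    (hX : σ.poly (-1) = distribution (cylinder B j v) f)
    (hD : ∀ π ∈ D, ¬ (π.length = j ∧ π.1.take v.length = v)) :
    Exec f (maxValues B f n) (commitProg v.length)
      ((L + 1) * ((L + 1) * (n * 3 + 6) + 3)) σ fun σ' =>
      Table B f L (D ∪ {π | π.length = j ∧ π.1.take v.length = v}) σ'.poly ∧
      ∀ a ≤ -10, σ'.int a = σ.int a := by
  have hT' : Table B f L D σ.poly :=
    ⟨by rw [hp 0 le_rfl, hT.1], fun i u hu => by rw [hp _ (by positivity), hT.2 i u hu]⟩
  refine ((exec_commitProg f (L := L) (n := n) ?_ hL h ?_ ?_ v.length le_rfl).imp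
    fun σ' h' => ⟨hT'.insert hv hD fun a => by rw [h'.1, hX], h'.2⟩).le ?_
  · intro x hx
    rcases List.mem_cons.1 hx with rfl | hx
    · exact hn
    · exact (hinj.2 x hx).2.trans hn
  · rw [hX]
    exact terms_le_maxValues B f hn (cylinder_subset _ _ _)
  · intro k hk
    refine hT'.terms_le hn ?_
    rw [List.length_take]; omega
  · gcongr

end Table

/-! ### Decision trees -/

/-- Decision trees whose tests compare differences of `d` numbers with constants. -/
inductive DTree (d : ℕ) (α : Type) : Type
  | leaf (a : α)
  | node (x y : Fin d) (c : ℤ) (t₁ t₂ : DTree d α)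

namespace DTree

variable {d : ℕ} {α : Type}

/-- The label of the leaf that is reached for the numbers `ρ`. -/
def eval (ρ : Fin d → ℤ) : DTree d α → α
  | leaf a => a
  | node x y c t₁ t₂ => if ρ x + c < ρ y then t₁.eval ρ else t₂.eval ρ

/-- The depth of a decision tree. -/
def depth : DTree d α → ℕ
  | leaf _ => 0
  | node _ _ _ t₁ t₂ => max t₁.depth t₂.depth + 1

/-- Find the leaf for the numbers in the cells `A x`, and run the program that belongs to it. -/
def compile {s : ℕ} (A : Fin d → ℤ) (g : α → Program s) : DTree d α → Program s
  | leaf a => g a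
  | node x y c t₁ t₂ => .seq (.const (-7) c) (.seq (.add (-7) (-7) (A x))
      (.seq (.sub (-7) (A y) (-7)) (.ifPos (-7) (t₁.compile A g) (t₂.compile A g))))

theorem exec_compile {s : ℕ} (f : Fin s → Permutation → ℤ) (W : ℕ) (A : Fin d → ℤ)
    (g : α → Program s) (ρ : Fin d → ℤ) (hA : ∀ x, A x ≠ -7) {Q : State s → Prop} {T : ℕ}
    (t : DTree d α) (σ : State s) (hρ : ∀ x, σ.int (A x) = ρ x)
    (h : ∀ σ', SameRegs σ σ' → Exec f W (g (t.eval ρ)) T σ' Q) :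
    Exec f W (t.compile A g) (4 * t.depth + T) σ Q := by
  induction t generalizing σ with
  | leaf a => exact (h σ (SameRegs.refl σ)).le (by simp [depth])
  | node x y c t₁ t₂ ih₁ ih₂ =>
    have hs : SameRegs σ (((σ.setInt (-7) c).setInt (-7) (c + ρ x)).setInt (-7)
        (ρ y - (c + ρ x))) := by
      repeat' refine SameRegs.setInt ?_ (by norm_num)
      exact SameRegs.refl σ
    refine (Exec.seq (T := 1) (Exec.const rfl) fun σ₁ e₁ => Exec.seq (T := 1) (Exec.add rfl)
      fun σ₂ e₂ => Exec.seq (T := 1) (Exec.sub rfl) fun σ₃ e₃ => Exec.ifPos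
        (T := 4 * max t₁.depth t₂.depth + T) (fun hx => ?_) fun hx => ?_).le
          (by simp only [depth]; omega)
    all_goals
      have e : σ₃ = ((σ.setInt (-7) c).setInt (-7) (c + ρ x)).setInt (-7) (ρ y - (c + ρ x)) := by
        rw [← e₃, ← e₂, ← e₁]; simp [hA, hρ]
      subst e
      simp at hx
    · refine (ih₁ _ (fun z => by simp [hA, hρ]) fun σ' h' => ?_).le (by omega)
      have := h σ' (hs.trans h')
      rwa [eval, if_pos (by omega)] at this
    · refine (ih₂ _ (fun z => by simp [hA, hρ]) fun σ' h' => ?_).le (by omega)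
      have := h σ' (hs.trans h')
      rwa [eval, if_neg (by omega)] at this

end DTree

/-! ### Computing one entry of the table -/

/-- For each entry `(i, c)` of the list, subtract `c` from the number in register `i` of the
current word; the results are kept in the registers `A 0, A 1, …`. -/
def moveProg {s : ℕ} : (ℕ → ℤ) → List (ℕ × ℤ) → Program s
  | _, [] => .skip
  | A, o :: os => .seq (.const (-7) o.2) (.seq (.sub (A 0) (regV o.1) (-7))
      (moveProg (fun i => A (i + 1)) os))

/-- The word `u` arises from `w` by selecting and decreasing letters as specified in `os`. -/
def Moves (os : List (ℕ × ℤ)) (w u : List ℕ) : Prop :=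
  List.Forall₂ (fun (o : ℕ × ℤ) (x : ℕ) => o.1 < w.length ∧ (w.getD o.1 0 : ℤ) - o.2 = x) os u

theorem exec_moveProg {s : ℕ} (f : Fin s → Permutation → ℤ) (W : ℕ) (w : List ℕ)
    (os : List (ℕ × ℤ)) (u : List ℕ) (h : Moves os w u) (A : ℕ → ℤ) (hA : ∀ i, A i ≤ -10)
    (hAV : ∀ i k, A i ≠ regV k) (hAi : Function.Injective A)
    (σ : State s) (hw : Holds σ (regs regV w.length) w) :
    Exec f W (moveProg A os) (os.length * 2 + 1) σ fun σ' =>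
      Holds σ' (regs A u.length) u ∧ σ'.poly = σ.poly ∧
      ∀ a ≤ -10, (∀ i, a ≠ A i) → σ'.int a = σ.int a := by
  induction h generalizing A σ with
  | nil =>
    refine (Exec.skip ⟨?_, rfl, fun _ _ _ => rfl⟩).le (by simp)
    exact .nil
  | @cons o x os u hox _ ih =>
    have h7 : regV o.1 ≠ -7 := by have := regV_le o.1; omega
    refine (Exec.seq (T := 1) (Exec.const rfl) fun σ₁ e₁ => Exec.seq (T := 1) (Exec.sub rfl)
      fun σ₂ e₂ => (ih (fun i => A (i + 1)) (fun i => hA _) (fun i k => hAV _ k)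
        (fun i k h => by simpa using hAi h) σ₂ ?_).imp fun σ₃ h₃ => ⟨?_, ?_, fun a ha hne => ?_⟩).le
          (by simp; omega)
    all_goals subst e₂; subst e₁
    · refine hw.congr fun a ha => ?_
      obtain ⟨k, -, rfl⟩ := List.mem_map.1 ha
      have := regV_le k
      simp [(hAV 0 k).symm, show regV k ≠ -7 by omega]
    · rw [List.length_cons, regs_succ]
      refine .cons ⟨hA 0, ?_⟩ h₃.1
      rw [h₃.2.2 _ (hA 0) fun i h => by simpa using hAi h]
      have := (holds_regs regV_le).1 hw o.1 hox.1
      simp [h7, this, ← hox.2, hox.1]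
    · rw [h₃.2.1]; rfl
    · rw [h₃.2.2 a ha fun i => hne _]
      simp [hne 0, show a ≠ -7 by omega]

/-- Replace the values of the statistics by their differences. -/
def diffProg {s : ℕ} : List (Fin s) → Program s
  | [] => .skip
  | i :: is => .seq (.sub (regE i) (regE i) (regE' i)) (diffProg is)

theorem exec_diffProg {s : ℕ} (f : Fin s → Permutation → ℤ) (W : ℕ) (is : List (Fin s))
    (his : is.Nodup) (σ : State s) :
    Exec f W (diffProg is) (is.length + 1) σ fun σ' => σ'.poly = σ.poly ∧
      (∀ i ∈ is, σ'.int (regE i) = σ.int (regE i) - σ.int (regE' i)) ∧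
      ∀ a, (∀ i ∈ is, a ≠ regE i) → σ'.int a = σ.int a := by
  induction is generalizing σ with
  | nil => exact (Exec.skip ⟨rfl, by simp, fun _ _ => rfl⟩).le (by simp)
  | cons i is ih =>
    rw [List.nodup_cons] at his
    have hEE : ∀ k l : Fin s, regE' k ≠ regE l := fun k l => by unfold regE regE'; omega
    refine (Exec.seq (T := 1) (Exec.sub rfl) fun σ₁ e₁ => (ih his.2 σ₁).imp fun σ₂ h₂ =>
      ⟨?_, fun k hk => ?_, fun a ha => ?_⟩).le (by simp; omega)
    all_goals subst e₁
    · exact h₂.1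
    · rcases List.mem_cons.1 hk with rfl | hk
      · rw [h₂.2.2 _ fun l hl (h : regE k = regE l) => his.1 (by rwa [regE_injective h])]
        simp
      · rw [h₂.2.1 k hk]
        have : k ≠ i := fun h => his.1 (h ▸ hk)
        simp [hEE, regE_injective.eq_iff, this]
    · rw [h₂.2.2 a fun k hk => ha k (by simp [hk])]
      simp [ha i (by simp)]

/-- What a label of a decision tree has to say about the word `v`: either no permutation in
`S_j(B)` begins with `v`, or the distribution over those which do arises from one that belongs to
a shorter permutation. -/
def LabelCorrect {s : ℕ} (B : Set VincularPattern) (f : Fin s → Permutation → ℤ) (j : ℕ)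
    (v : List ℕ) : Option (List (ℕ × ℤ)) → Prop
  | none => cylinder B j v = ∅
  | some os => ∃ (hv : IsInjWord j v) (j' : ℕ) (v' : List ℕ) (hv' : IsInjWord j' v'),
      j' < j ∧ v'.length ≤ v.length ∧ Moves os (j :: v) (j' :: v') ∧
      distribution (cylinder B j v) f =
        monomial (fun i => f i (extPerm j v hv) - f i (extPerm j' v' hv')) *
          distribution (cylinder B j' v') f

/-- Compute the entry for the current word, and add it to the entries of its prefixes. -/
def entryProg {s : ℕ} (L : ℕ) : Option (List (ℕ × ℤ)) → Program s
  | none => .skip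
  | some os => .seq (statProg regV L regE) (.seq (moveProg regV' os)
      (.seq (statProg regV' (os.length - 1) regE') (.seq (diffProg (List.finRange s))
        (.seq (encProg (regs regV' os.length)) (.seq (.const (-8) (-1))
          (.seq (.shift (-8) regE (-1)) (commitProg L)))))))

/-- A bound on the running time of `entryProg`. -/
def entryTime (s L n : ℕ) : ℕ :=
  statTime s L n + ((L + 1) * 2 + 1 + (statTime s L n + (s + 1 + ((L + 1) * (n * 3 + 6) + 1 +
    (1 + (1 + (L + 1) * ((L + 1) * (n * 3 + 6) + 3)))))))

/-- By `hD'` all shorter permutations have been counted, so the entry of the image word `v'`, which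
belongs to a length `j' < j`, is complete when it is read. -/
theorem exec_entryProg {s : ℕ} {B : Set VincularPattern} (f : Fin s → Permutation → ℤ)
    {n L j : ℕ} {v : List ℕ} (hL : v.length = L) (hn : j ≤ n) (D : Set Permutation)
    (lab : Option (List (ℕ × ℤ))) (hlab : LabelCorrect B f j v lab) (σ : State s)
    (h : Holds σ (regs regV (v.length + 1)) (j :: v)) (hT : Table B f L D σ.poly)
    (hD : ∀ π ∈ D, ¬ (π.length = j ∧ π.1.take v.length = v))
    (hD' : ∀ π : Permutation, π.length < j → π ∈ D) :
    Exec f (maxValues B f n) (entryProg L lab) (entryTime s L n) σ fun σ' =>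
      Table B f L (D ∪ {π | π.length = j ∧ π.1.take v.length = v}) σ'.poly ∧
      ∀ a ≤ -10, a % 4 = 0 → σ'.int a = σ.int a := by
  classical
  cases lab with
  | none => exact (Exec.skip ⟨hT.insert_empty hlab, fun _ _ _ => rfl⟩).le (by
      unfold entryTime; omega)
  | some os =>
    obtain ⟨hv, j', v', hv', hj', hlen, hmov, hdist⟩ := hlab
    have hos : os.length = v'.length + 1 := by simpa using List.Forall₂.length_eq hmov
    subst hL
    -- The four families of registers lie in different residue classes modulo `4`; the current word
    -- occupies the class of `0`.
    have hE4 : ∀ (a : ℤ) (i : Fin s), a % 4 = 0 → a ≠ regE i := fun a i ha => by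
      unfold regE; omega
    have hE'4 : ∀ (a : ℤ) (i : Fin s), a % 4 = 0 → a ≠ regE' i := fun a i ha => by
      unfold regE'; omega
    have hV'4 : ∀ (a : ℤ) (i : ℕ), a % 4 = 0 → a ≠ regV' i := fun a i ha => by
      unfold regV'; omega
    have hV4 : ∀ i, regV i % 4 = 0 := fun i => by unfold regV; omega
    have hEV' : ∀ (i : Fin s) k, regE i ≠ regV' k := fun i k => by unfold regE regV'; omega
    have hE'V' : ∀ (i : Fin s) k, regE' i ≠ regV' k := fun i k => by unfold regE' regV'; omega
    have hEE' : ∀ i k : Fin s, regE i ≠ regE' k := fun i k => by unfold regE regE'; omega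
    have hV'i : Function.Injective regV' := fun i k h => by unfold regV' at h; omega
    rw [entryProg, hos, Nat.add_sub_cancel]
    refine (exec_statProg f _ σ regV regE regV_le regE_le (fun i => (hE4 _ i (hV4 0)).symm)
      regE_injective hv hn le_rfl h).seq fun σ₁ h₁ => ?_
    have hV₁ : Holds σ₁ (regs regV (v.length + 1)) (j :: v) := h.congr fun a ha => by
      obtain ⟨k, -, rfl⟩ := List.mem_map.1 ha
      exact h₁.2.2 _ (regV_le k) fun i => hE4 _ i (hV4 k)
    have hmove := exec_moveProg f (maxValues B f n) (j :: v) os (j' :: v') hmov regV' regV'_le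
      (fun i k => (hV'4 _ i (hV4 k)).symm) hV'i σ₁ (by simpa using hV₁)
    refine (hmove.le (T' := (v.length + 1) * 2 + 1) (by rw [hos]; omega)).seq fun σ₂ h₂ => ?_
    refine (exec_statProg f _ σ₂ regV' regE' regV'_le regE'_le (fun i => hE'V' i 0)
      regE'_injective hv' (hj'.le.trans hn) hlen (by simpa using h₂.1)).seq fun σ₃ h₃ => ?_
    have hV'₃ : Holds σ₃ (regs regV' (v'.length + 1)) (j' :: v') := by
      have := h₂.1
      rw [List.length_cons] at this
      refine this.congr fun a ha => ?_
      obtain ⟨k, -, rfl⟩ := List.mem_map.1 ha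
      exact h₃.2.2 _ (regV'_le k) fun i => (hE'V' i k).symm
    refine ((exec_diffProg f _ (List.finRange s) (List.nodup_finRange s) σ₃).le
      (T' := s + 1) (by simp)).seq fun σ₄ h₄ => ?_
    have hV'₄ : Holds σ₄ (regs regV' (v'.length + 1)) (j' :: v') := by
      refine hV'₃.congr fun a ha => ?_
      obtain ⟨k, -, rfl⟩ := List.mem_map.1 ha
      exact h₄.2.2 _ fun i _ => (hEV' i k).symm
    have hE₄ : ∀ i, σ₄.int (regE i) = f i (extPerm j v hv) - f i (extPerm j' v' hv') := by
      intro i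
      rw [h₄.2.1 i (List.mem_finRange i), h₃.2.1 i, h₃.2.2 _ (regE_le i) (hEE' i),
        h₂.2.2 _ (regE_le i) (hEV' i), h₁.2.1 i]
    have hp₄ : σ₄.poly = σ.poly := by rw [h₄.1, h₃.1, h₂.2.1, h₁.1]
    refine ((exec_encProg f _ n σ₄ _ _ hV'₄ ?_).le (T' := (v.length + 1) * (n * 3 + 6) + 1)
      ?_).seq fun σ₅ h₅ => ?_
    · intro x hx
      rcases List.mem_cons.1 hx with rfl | hx
      · exact hj'.le.trans hn
      · exact (hv'.2 x hx).2.trans (hj'.le.trans hn)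
    · rw [length_regs]; gcongr
    refine Exec.seq (T := 1) (Exec.const rfl) fun σ₆ h₆ => Exec.seq (T := 1)
      (Exec.shift ?_ rfl) fun σ₇ h₇ => ?_
    · subst h₆
      simp only [State.setInt_int, State.setInt_poly]
      norm_num
      rw [h₅.2, h₅.1.1, hp₄]
      exact hT.terms_le (hj'.le.trans hn) hlen
    have hkeep : ∀ a ≤ -10, a % 4 = 0 → σ₇.int a = σ.int a := by
      intro a ha ha4
      subst h₇; subst h₆
      simp only [State.setPoly_int, State.setInt_int, show a ≠ -8 by omega, if_false]
      rw [h₅.1.2 a ha, h₄.2.2 a fun i _ => hE4 a i ha4, h₃.2.2 a ha fun i => hE'4 a i ha4,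
        h₂.2.2 a ha fun i => hV'4 a i ha4, h₁.2.2 a ha fun i => hE4 a i ha4]
    refine (exec_commit_table (σ₀ := σ) (σ := σ₇) hn hv le_rfl (Or.inl rfl) ?_ hT ?_ ?_ hD).imp
      fun σ' h' => ⟨h'.1, fun a ha ha4 => by rw [h'.2 a ha, hkeep a ha ha4]⟩
    · refine h.congr fun a ha => ?_
      obtain ⟨k, -, rfl⟩ := List.mem_map.1 ha
      exact hkeep _ (regV_le k) (hV4 k)
    · intro a ha
      subst h₇; subst h₆
      simp [show a ≠ -1 by omega, h₅.1.1, hp₄]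
    · subst h₇; subst h₆
      have : ∀ i : Fin s, regE i ≠ -8 := fun i => by have := regE_le i; omega
      simp only [State.setInt_int, State.setInt_poly, State.setPoly_poly, this, if_false]
      norm_num
      rw [h₅.2, h₅.1.1, hp₄, hT.2 j' v' hlen, hdist]
      congr 2
      · funext i
        rw [h₅.1.2 _ (regE_le i), hE₄ i]
      · refine Finset.filter_true_of_mem fun π hπ => hD' π ?_
        rw [(mem_avoiders.1 (cylinder_subset _ _ _ hπ)).1]
        exact hj'

/-! ### Looping over all words -/

/-- The numbers that decision trees look at: `0`, `j` and the letters of `v`. -/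
def env (d j : ℕ) (v : List ℕ) : Fin d → ℤ := fun x => (((0 :: j :: v).getD x 0 : ℕ) : ℤ)

/-- The cells of these numbers. -/
def envCell {d : ℕ} (x : Fin d) : ℤ := if (x : ℕ) = 0 then -6 else regV ((x : ℕ) - 1)

/-- Loop over all ways to extend the current word, which has length `i`, by `k` letters, and
compute the entries of the table for them. -/
def nestProg {s : ℕ} (L : ℕ) (tree : DTree (L + 2) (Option (List (ℕ × ℤ)))) :
    ℕ → ℕ → Program s
  | _, 0 => .seq (.const (-6) 0) (tree.compile envCell (entryProg L))
  | i, k + 1 => forLoop (regV (i + 1)) (regV 0) 0 (nestProg L tree (i + 1) k)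

/-- A bound on the running time of `nestProg`. -/
def nestTime (s L depth n : ℕ) : ℕ → ℕ
  | 0 => 1 + (4 * depth + entryTime s L n)
  | k + 1 => 2 + (n * (nestTime s L depth n k + 4) + 1)

/-- The loops also visit words with repeated letters; for these `LabelCorrect` leaves only the label
`none`. The registers of the letters after `u` change, so only cells above them are claimed to be
preserved. -/
theorem exec_nestProg {s : ℕ} {B : Set VincularPattern} (f : Fin s → Permutation → ℤ) {n L j : ℕ}
    (tree : DTree (L + 2) (Option (List (ℕ × ℤ)))) (hn : j ≤ n) (hLj : L ≤ j)
    (htree : ∀ v : List ℕ, v.length = L → (∀ x ∈ v, 1 ≤ x ∧ x ≤ j) →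
      LabelCorrect B f j v (tree.eval (env (L + 2) j v)))
    (k : ℕ) (u : List ℕ) (hk : u.length + k = L) (hu : ∀ x ∈ u, 1 ≤ x ∧ x ≤ j)
    (D : Set Permutation) (hD : ∀ π ∈ D, ¬ (π.length = j ∧ π.1.take u.length = u))
    (hD' : ∀ π : Permutation, π.length < j → π ∈ D) (σ : State s)
    (h : Holds σ (regs regV (u.length + 1)) (j :: u)) (hT : Table B f L D σ.poly) :
    Exec f (maxValues B f n) (nestProg L tree u.length k) (nestTime s L tree.depth n k) σ fun σ' =>
      Table B f L (D ∪ {π | π.length = j ∧ π.1.take u.length = u}) σ'.poly ∧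
      ∀ a ≤ -10, a % 4 = 0 → regV (u.length + 1) < a → σ'.int a = σ.int a := by
  induction k generalizing u D σ with
  | zero =>
    refine Exec.seq (T := 1) (Exec.const rfl) fun σ₁ e₁ => DTree.exec_compile f _ _ _
      (env (L + 2) j u) ?_ tree σ₁ ?_ fun σ₂ h₂ => ?_
    · intro x
      unfold envCell
      have := regV_le ((x : ℕ) - 1)
      split_ifs <;> omega
    · subst e₁
      rintro ⟨x, hx⟩
      rcases x with _ | x
      · simp [envCell, env]
      · have h6 : regV x ≠ -6 := by have := regV_le x; omega
        have := (holds_regs (l := j :: u) regV_le).1 h x (by simp; omega)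
        have hx' : x < (j :: u).length := by simp; omega
        simp only [envCell, env, Nat.add_one_ne_zero, if_false, Nat.add_sub_cancel,
          State.setInt_int, h6, this, List.getD_cons_succ]
        rw [List.getD_eq_getElem _ _ hx']
    · have hs : SameRegs σ σ₂ :=
        SameRegs.trans (by subst e₁; exact (SameRegs.refl σ).setInt (by norm_num)) h₂
      refine (exec_entryProg f (by simpa using hk) hn D _ (htree u (by simpa using hk) hu) σ₂
        (h.of_same hs) (by rw [hs.1]; exact hT) hD hD').imp fun σ₃ h₃ => ⟨h₃.1, fun a ha ha4 _ => ?_⟩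
      rw [h₃.2 a ha ha4, hs.2 a ha]
  | succ k ih =>
    have hVne : ∀ i l, i ≠ l → regV i ≠ regV l := fun i l h => by unfold regV; omega
    have hlt : ∀ i, regV (i + 1) < regV i := fun i => by unfold regV; omega
    have hV4 : ∀ i, regV i % 4 = 0 := fun i => by unfold regV; omega
    have h0 : σ.int (regV 0) = j := by
      exact (holds_regs (l := j :: u) regV_le).1 h 0 (by simp)
    have hgt : ∀ i ≤ u.length, regV (u.length + 1) < regV i := fun i hi => by unfold regV; omega
    -- After `x` rounds, the permutations that have been added are those whose letter after `u` is
    -- at most `x`.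
    let S : ℕ → Set Permutation := fun x =>
      {π | π.length = j ∧ π.1.take u.length = u ∧ π.1.getD u.length 0 ≤ x}
    have hsplit : ∀ (x : ℕ) (π : Permutation), π.length = j →
        (π.1.take (u.length + 1) = u ++ [x] ↔
          π.1.take u.length = u ∧ π.1.getD u.length 0 = x) := by
      intro x π hπ
      have hl : u.length < π.1.length := by change u.length < π.length; omega
      rw [List.take_add_one, List.getElem?_eq_getElem hl, List.getD_eq_getElem _ _ hl,
        Option.toList_some]
      refine ⟨fun h => ?_, fun ⟨h1, h2⟩ => by rw [h1, h2]⟩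
      simpa using List.append_inj' h rfl
    refine ((Exec.forLoop (T := nestTime s L tree.depth n k) (a := 0) (b := j) (fun x σ' =>
      σ'.int (regV (u.length + 1)) = x ∧
      (∀ a ≤ -10, a % 4 = 0 → regV (u.length + 1) < a → σ'.int a = σ.int a) ∧
      Table B f L (D ∪ S x) σ'.poly) ?_ (hVne _ _ (by omega)) h0 ?_ ?_ ?_ ?_).imp
        fun σ' h' => ⟨h'.2.2.congr fun π _ => ?_, h'.2.1⟩).le ?_
    · have := regV_le (u.length + 1); omega
    · rintro x σ' ⟨h1, h2, -⟩
      exact ⟨h1, by rw [h2 _ (regV_le 0) (hV4 0) (hgt 0 (Nat.zero_le _)), h0]⟩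
    · rintro x σ' c ⟨h1, h2, h3⟩
      refine ⟨?_, fun a ha ha4 hau => ?_, h3⟩
      · have := regV_le (u.length + 1)
        simp [h1, show regV (u.length + 1) ≠ -9 by omega]
      · simp [show a ≠ -9 by omega, h2 a ha ha4 hau]
    · rintro x σ' - hx ⟨h1, h2, h3⟩
      set σ₁ := (σ'.setInt (-3) 1).setInt (regV (u.length + 1)) (x + 1 : ℕ) with hσ₁
      have hσ₁a : ∀ a ≤ -10, a % 4 = 0 → regV (u.length + 1) < a → σ₁.int a = σ.int a := by
        intro a ha ha4 hau
        rw [hσ₁]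
        simp [show a ≠ regV (u.length + 1) by omega, show a ≠ -3 by omega, h2 a ha ha4 hau]
      have key := ih (u ++ [x + 1]) (by simp; omega) ?_ (D ∪ S x) ?_
        (fun π hπ => Or.inl (hD' π hπ)) σ₁ ?_ h3
      · rw [List.length_append, List.length_singleton] at key
        refine key.imp fun σ₂ h₂ => ⟨?_, fun a ha ha4 hau => ?_, h₂.1.congr fun π _ => ?_⟩
        · rw [h₂.2 _ (regV_le _) (hV4 _) (hlt _), hσ₁]
          simp
        · rw [h₂.2 a ha ha4 ((hlt _).trans hau), hσ₁a a ha ha4 hau]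
        · simp only [Set.mem_union, S, Set.mem_ofPred_eq]
          by_cases hπ : π.length = j
          · simp only [hπ, true_and, hsplit (x + 1) π hπ]
            have : π.1.getD u.length 0 ≤ x + 1 ↔
              π.1.getD u.length 0 ≤ x ∨ π.1.getD u.length 0 = x + 1 := by omega
            tauto
          · simp [hπ]
      · intro y hy
        rcases List.mem_append.1 hy with hy | hy
        · exact hu y hy
        · simp at hy; omega
      · rintro π (hπ | hπ)
        · rintro ⟨h4, h5⟩
          rw [List.length_append, List.length_singleton, hsplit _ π h4] at h5
          exact hD π hπ ⟨h4, h5.1⟩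
        · rintro ⟨h4, h5⟩
          rw [List.length_append, List.length_singleton, hsplit _ π h4] at h5
          have := hπ.2.2
          omega
      · have hh := (holds_regs (l := j :: u) regV_le).1 h
        have goal := (holds_regs (σ := σ₁) (l := j :: (u ++ [x + 1])) regV_le).2 ?_
        · simpa using goal
        · intro i hi
          have hi' : i < u.length + 2 := by simp at hi; omega
          by_cases hiu : i = u.length + 1
          · subst hiu
            rw [hσ₁]
            simp
          · rw [hσ₁a _ (regV_le i) (hV4 i) (hgt i (by omega)), hh i (by simp; omega)]
            rcases i with _ | i
            · simp
            · simp [List.getElem_append_left (show i < u.length by omega)]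
    · refine ⟨by simp, fun a ha ha4 hau => ?_, hT.congr fun π _ => ?_⟩
      · simp [show a ≠ regV (u.length + 1) by omega]
      -- Letters are at least `1`, so `S 0` is empty.
      · refine ⟨Or.inl, fun hπ => hπ.resolve_right fun h4 => ?_⟩
        have hl : u.length < π.1.length := by
          have h5 := h4.1; change u.length < π.length; omega
        have h6 := h4.2.2
        rw [List.getD_eq_getElem _ _ hl] at h6
        have := (π.isInjWord.2 _ (List.getElem_mem hl)).1
        omega
    · rw [Nat.sub_zero, nestTime]
      gcongr
    · rw [Nat.zero_max]
      simp only [Set.mem_union, S, Set.mem_ofPred_eq]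
      -- Letters are at most `j`, so `S j` imposes no condition on the next letter.
      refine or_congr_right ⟨fun h4 => ⟨h4.1, h4.2.1⟩, fun h4 => ⟨h4.1, h4.2, ?_⟩⟩
      have hl : u.length < π.1.length := by
        have h5 := h4.1; change u.length < π.length; omega
      rw [List.getD_eq_getElem _ _ hl, ← h4.1]
      exact (π.isInjWord.2 _ (List.getElem_mem hl)).2

/-! ### Short permutations -/

/-- Write the constants `l` into the cells `A 0, A 1, …`. -/
def constProg {s : ℕ} : (ℕ → ℤ) → List ℕ → Program s
  | _, [] => .skip
  | A, x :: l => .seq (.const (A 0) x) (constProg (fun i => A (i + 1)) l)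

theorem exec_constProg {s : ℕ} (f : Fin s → Permutation → ℤ) (W : ℕ) (l : List ℕ) (A : ℕ → ℤ)
    (hA : ∀ i, A i ≤ -10) (hAi : Function.Injective A) (σ : State s) :
    Exec f W (constProg A l) (l.length + 1) σ fun σ' =>
      Holds σ' (regs A l.length) l ∧ σ'.poly = σ.poly ∧
      ∀ a, (∀ i, a ≠ A i) → σ'.int a = σ.int a := by
  induction l generalizing A σ with
  | nil =>
    refine (Exec.skip ⟨?_, rfl, fun _ _ => rfl⟩).le (by simp)
    exact .nil
  | cons x l ih =>
    refine (Exec.seq (T := 1) (Exec.const rfl) fun σ₁ e₁ => (ih (fun i => A (i + 1))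
      (fun i => hA _) (fun i k h => by simpa using hAi h) σ₁).imp fun σ₂ h₂ =>
        ⟨?_, ?_, fun a ha => ?_⟩).le (by simp; omega)
    all_goals subst e₁
    · rw [List.length_cons, regs_succ]
      refine .cons ⟨hA 0, ?_⟩ h₂.1
      rw [h₂.2.2 _ fun i h => by simpa using hAi h]
      simp
    · exact h₂.2.1
    · rw [h₂.2.2 a fun i => ha _]
      simp [ha 0]

/-- Enter the permutation `π` into the table. -/
def shortProg {s : ℕ} (π : Permutation) : Program s :=
  .seq (constProg regV (π.length :: π.1)) (.seq (statProg regV π.1.length regE)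
    (.seq (.const (-8) (-1)) (.seq (.one (-8)) (.seq (.shift (-8) regE (-8))
      (commitProg π.1.length)))))

theorem terms_one_le {s : ℕ} : terms (1 : Laurent s) ≤ 1 := by
  rw [terms, AddMonoidAlgebra.one_def, AddMonoidAlgebra.coeff_single]
  exact (Finset.card_le_card Finsupp.support_single_subset).trans (by simp)

/-- A bound on the running time of `shortProg`. -/
def shortTime (s L n : ℕ) : ℕ :=
  L + 2 + (statTime s L n + (1 + (1 + (1 + (L + 1) * ((L + 1) * (n * 3 + 6) + 3)))))

theorem one_le_maxValues {s : ℕ} {B : Set VincularPattern} {f : Fin s → Permutation → ℤ} {n : ℕ}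
    {π : Permutation} (hn : π.length ≤ n) (hB : ∀ τ ∈ B, ¬ Contains π τ) :
    1 ≤ maxValues B f n := by
  have hm : π ∈ avoiders π.length B := mem_avoiders.2 ⟨rfl, hB⟩
  refine le_trans ?_ (Finset.le_sup
    (f := fun j => ((avoiders j B).image fun π i => f i π).card) (Finset.mem_range.2
      (Nat.lt_succ_of_le hn)))
  exact Finset.card_pos.2 ⟨_, Finset.mem_image_of_mem _ hm⟩

theorem length_eq_take_iff {π π' : Permutation} :
    π'.length = π.length ∧ π'.1.take π.1.length = π.1 ↔ π' = π := by
  constructor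
  · rintro ⟨h1, h2⟩
    apply Subtype.ext
    rw [← h2, List.take_of_length_le]
    exact h1.le
  · rintro rfl
    simp

/-- A permutation is the only one of its length that begins with its full word, so its cylinder is a
singleton and its entry a single monomial, obtained by shifting `1`. -/
theorem exec_shortProg {s : ℕ} {B : Set VincularPattern} (f : Fin s → Permutation → ℤ) {n L : ℕ}
    (hn : L ≤ n) (π : Permutation) (hπL : π.length < L) (hπB : ∀ τ ∈ B, ¬ Contains π τ)
    (D : Set Permutation) (hD : π ∉ D) (σ : State s) (hT : Table B f L D σ.poly) :
    Exec f (maxValues B f n) (shortProg π) (shortTime s L n) σ fun σ' =>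
      Table B f L (D ∪ {π}) σ'.poly ∧ σ'.int (-16) = σ.int (-16) := by
  have hlen : π.1.length = π.length := rfl
  have hVE : ∀ (i : Fin s) k, regE i ≠ regV k := fun i k => by unfold regE regV; omega
  have hVi : Function.Injective regV := fun i k h => by unfold regV at h; omega
  have hcyl : cylinder B π.length π.1 = {π} := by
    ext π'
    rw [cylinder, Finset.mem_filter, mem_avoiders, Finset.mem_singleton]
    constructor
    · rintro ⟨⟨h1, -⟩, h2⟩
      exact length_eq_take_iff.1 ⟨h1, h2⟩
    · rintro rfl
      exact ⟨⟨rfl, hπB⟩, by simp⟩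
  have h16V : ∀ i, (-16 : ℤ) ≠ regV i := fun i => by unfold regV; omega
  have h16E : ∀ i : Fin s, (-16 : ℤ) ≠ regE i := fun i => by unfold regE; omega
  have hE8 : ∀ i : Fin s, regE i ≠ -8 := fun i => by have := regE_le i; omega
  refine ((exec_constProg f _ (π.length :: π.1) regV regV_le hVi σ).le (T' := L + 2)
    (by simp; omega)).seq fun σ₁ h₁ => ?_
  refine Exec.seq (exec_statProg f _ σ₁ regV regE regV_le regE_le
    (fun i => hVE i 0) regE_injective π.isInjWord (n := n) (L := L) (by omega) (by omega)
      (by simpa using h₁.1)) fun σ₂ h₂ => ?_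
  refine Exec.seq (T := 1) (Exec.const rfl) fun σ₃ h₃ => Exec.seq (T := 1) (Exec.one rfl)
    fun σ₄ h₄ => Exec.seq (T := 1) (Exec.shift ?_ rfl) fun σ₅ h₅ => ?_
  · subst h₄; subst h₃
    -- The operand `1` has one term, and the bound on operands is positive because `π` itself is an
    -- avoider.
    simpa using terms_one_le.trans (one_le_maxValues (by omega) hπB)
  have hkeep : ∀ a ≤ -10, (∀ i : Fin s, a ≠ regE i) → σ₅.int a = σ₁.int a := by
    intro a ha haE
    subst h₅; subst h₄; subst h₃
    simp [show a ≠ -8 by omega, h₂.2.2 a ha haE]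
  refine (exec_commit_table (n := n) (σ₀ := σ) (by omega) π.isInjWord (by omega) (Or.inr hlen)
    ?_ hT ?_ ?_ ?_).imp fun σ₆ h₆ => ⟨h₆.1.congr fun π' _ => ?_, ?_⟩
  · refine Holds.congr (σ := σ₁) (by simpa using h₁.1) fun a ha => ?_
    obtain ⟨k, -, rfl⟩ := List.mem_map.1 ha
    exact hkeep _ (regV_le k) fun i => (hVE i k).symm
  · intro a ha
    subst h₅; subst h₄; subst h₃
    simp [show a ≠ -1 by omega, h₂.1, h₁.2.1]
  · subst h₅; subst h₄; subst h₃
    rw [hcyl]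
    simp [hE8, h₂.2.1, distribution, extPerm_self]
  · intro π' hπ' h
    exact hD (length_eq_take_iff.1 h ▸ hπ')
  · simp only [Set.mem_union, Set.mem_ofPred_eq, Set.mem_singleton_iff, length_eq_take_iff]
  · rw [h₆.2 _ (by norm_num), hkeep _ (by norm_num) h16E, h₁.2.2 _ h16V]

/-- Enter the permutations in the list into the table. -/
def shortListProg {s : ℕ} : List Permutation → Program s
  | [] => .skip
  | π :: l => .seq (shortProg π) (shortListProg l)

theorem exec_shortListProg {s : ℕ} {B : Set VincularPattern} (f : Fin s → Permutation → ℤ)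
    {n L : ℕ} (hn : L ≤ n) (l : List Permutation)
    (hl : ∀ π ∈ l, π.length < L ∧ ∀ τ ∈ B, ¬ Contains π τ)
    (hnd : l.Nodup) (D : Set Permutation) (hD : ∀ π ∈ l, π ∉ D) (σ : State s)
    (hT : Table B f L D σ.poly) :
    Exec f (maxValues B f n) (shortListProg l) (l.length * shortTime s L n + 1) σ fun σ' =>
      Table B f L (D ∪ {π | π ∈ l}) σ'.poly ∧ σ'.int (-16) = σ.int (-16) := by
  induction l generalizing D σ with
  | nil => exact (Exec.skip ⟨hT.congr fun π _ => by simp, rfl⟩).le (by simp)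
  | cons π l ih =>
    rw [List.nodup_cons] at hnd
    obtain ⟨hπL, hπB⟩ := hl π (by simp)
    refine ((exec_shortProg f hn π hπL hπB D (hD π (by simp)) σ hT).seq fun σ₁ h₁ =>
      (ih (fun π' h => hl π' (by simp [h])) hnd.2 (D ∪ {π}) (fun π' h h' => ?_) σ₁ h₁.1).imp
        fun σ₂ h₂ => ⟨h₂.1.congr fun π' _ => ?_, h₂.2.trans h₁.2⟩).le (Nat.le_of_eq ?_)
    · rcases h' with h' | h'
      · exact hD π' (by simp [h]) h'
      · rw [Set.mem_singleton_iff] at h'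
        exact hnd.1 (h' ▸ h)
    · rw [List.length_cons]; ring
    · simp only [Set.mem_union, Set.mem_singleton_iff, Set.mem_ofPred_eq, List.mem_cons, or_assoc]

/-! ### Polynomial bounds -/

/-- `T` is bounded by a polynomial. -/
def PolyBounded (T : ℕ → ℕ) : Prop := ∃ C : ℕ, ∀ n, T n ≤ C * (n + 1) ^ C

namespace PolyBounded

theorem const (c : ℕ) : PolyBounded fun _ => c :=
  ⟨c, fun n => Nat.le_mul_of_pos_right _ (by positivity)⟩

theorem id : PolyBounded fun n => n := ⟨1, fun n => by simp⟩

theorem add {T T' : ℕ → ℕ} (h : PolyBounded T) (h' : PolyBounded T') :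
    PolyBounded fun n => T n + T' n := by
  obtain ⟨C, hC⟩ := h
  obtain ⟨C', hC'⟩ := h'
  refine ⟨C + C', fun n => ?_⟩
  rw [add_mul]
  refine add_le_add ((hC n).trans ?_) ((hC' n).trans ?_)
  · exact Nat.mul_le_mul_left _ (Nat.pow_le_pow_right (by omega) (by omega))
  · exact Nat.mul_le_mul_left _ (Nat.pow_le_pow_right (by omega) (by omega))

theorem mul {T T' : ℕ → ℕ} (h : PolyBounded T) (h' : PolyBounded T') :
    PolyBounded fun n => T n * T' n := by
  obtain ⟨C, hC⟩ := h
  obtain ⟨C', hC'⟩ := h'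
  refine ⟨C * C' + (C + C'), fun n => (Nat.mul_le_mul (hC n) (hC' n)).trans ?_⟩
  calc C * (n + 1) ^ C * (C' * (n + 1) ^ C') = C * C' * (n + 1) ^ (C + C') := by ring
    _ ≤ _ := Nat.mul_le_mul (by omega) (Nat.pow_le_pow_right (by omega) (by omega))

end PolyBounded

/-- The argument `n + L` dominates `max n L`, the largest length that can occur. -/
theorem polyBounded_statTime (s k L : ℕ) : PolyBounded fun n => statTime s k (n + L) := by
  have hn : PolyBounded fun n => n + L := .add .id (.const L)
  exact .add (.add (.const _) (.mul hn (.const _)))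
    (.add (.mul (.const _) (.add hn (.const _))) (.const _))

theorem polyBounded_commitTime (L : ℕ) :
    PolyBounded fun n => (L + 1) * ((L + 1) * ((n + L) * 3 + 6) + 3) := by
  have hn : PolyBounded fun n => n + L := .add .id (.const L)
  exact .mul (.const _) (.add (.mul (.const _) (.add (.mul hn (.const _)) (.const _))) (.const _))

theorem polyBounded_shortTime (s L : ℕ) : PolyBounded fun n => shortTime s L (n + L) :=
  .add (.const _) (.add (polyBounded_statTime _ _ _) (.add (.const _) (.add (.const _)
    (.add (.const _) (polyBounded_commitTime L)))))

theorem polyBounded_entryTime (s L : ℕ) : PolyBounded fun n => entryTime s L (n + L) := by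
  have hn : PolyBounded fun n => n + L := .add .id (.const L)
  exact .add (polyBounded_statTime _ _ _) (.add (.const _) (.add (polyBounded_statTime _ _ _)
    (.add (.const _) (.add (.add (.mul (.const _) (.add (.mul hn (.const _)) (.const _)))
      (.const _)) (.add (.const _) (.add (.const _) (polyBounded_commitTime L)))))))

theorem polyBounded_nestTime (s L depth k : ℕ) :
    PolyBounded fun n => nestTime s L depth (n + L) k := by
  have hn : PolyBounded fun n => n + L := .add .id (.const L)
  induction k with
  | zero => exact .add (.const _) (.add (.const _) (polyBounded_entryTime _ _))
  | succ k ih => exact .add (.const _) (.add (.mul hn (.add ih (.const _))) (.const _))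

theorem nestTime_mono (s L depth k : ℕ) {n n' : ℕ} (h : n ≤ n') :
    nestTime s L depth n k ≤ nestTime s L depth n' k := by
  induction k with
  | zero => unfold nestTime entryTime statTime; gcongr
  | succ k ih => unfold nestTime; gcongr

/-! ### The whole program -/

/-- Fill the table and output the distribution over `S_n(B)`. -/
def mainProg {s : ℕ} (L : ℕ) (l : List Permutation)
    (tree : DTree (L + 2) (Option (List (ℕ × ℤ)))) : Program s :=
  .seq (.const (-6) 0) (.seq (.add (-16) 0 (-6)) (.seq (shortListProg l)
    (.seq (forLoop (regV 0) (-16) ((L - 1 : ℕ) : ℤ) (nestProg L tree 0 L))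
      (.seq (encProg [-16]) (.seq (.const (-6) 0) (.polyAdd (-6) (-1) (-6)))))))

/-- A bound on the running time of `mainProg`. -/
def mainTime (s L depth len n : ℕ) : ℕ :=
  1 + (1 + (len * shortTime s L n + 1 + (2 + (n * (nestTime s L depth n L + 4) + 1) +
    (1 * (n * 3 + 6) + 1 + (1 + 1)))))

theorem polyBounded_mainTime (s L depth len : ℕ) :
    PolyBounded fun n => mainTime s L depth len (n + L) := by
  have hn : PolyBounded fun n => n + L := .add .id (.const L)
  exact .add (.const _) (.add (.const _) (.add (.add (.mul (.const _) (polyBounded_shortTime _ _))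
    (.const _)) (.add (.add (.const _) (.add (.mul hn (.add (polyBounded_nestTime _ _ _ _)
      (.const _))) (.const _))) (.add (.add (.mul (.const _) (.add (.mul hn (.const _)) (.const _)))
        (.const _)) (.const _)))))

/-- The input is first moved to cell `-16`, since stored permutations overwrite cell `0`. The
address `-16` is divisible by `4` and above every `regV i`, so the loops preserve it. The outer loop
starts from `L - 1` and thus treats the lengths `L, …, n`; it is empty if `n < L`. -/
theorem exec_mainProg {s : ℕ} {B : Set VincularPattern} (f : Fin s → Permutation → ℤ) {L : ℕ}
    (hL : 1 ≤ L) (l : List Permutation) (hnd : l.Nodup)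
    (hl : ∀ π, π ∈ l ↔ π.length < L ∧ ∀ τ ∈ B, ¬ Contains π τ)
    (tree : DTree (L + 2) (Option (List (ℕ × ℤ))))
    (htree : ∀ (j : ℕ) (v : List ℕ), L ≤ j → v.length = L → (∀ x ∈ v, 1 ≤ x ∧ x ≤ j) →
      LabelCorrect B f j v (tree.eval (env (L + 2) j v))) (n : ℕ) :
    Exec f (maxValues B f (max n L)) (mainProg L l tree)
      (mainTime s L tree.depth l.length (n + L)) (State.init s n)
      fun σ => σ.poly 0 = distribution (avoiders n B) f := by
  have h16 : ∀ i, (-16 : ℤ) ≠ regV i := fun i => by unfold regV; omega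
  have hV0 := regV_le 0
  have hle : max n L ≤ n + L := by omega
  refine Exec.seq (T := 1) (Exec.const rfl) fun σ₁ e₁ => Exec.seq (T := 1) (Exec.add rfl)
    fun σ₂ e₂ => ?_
  have h₂ : σ₂.int (-16) = n := by
    subst e₂; subst e₁
    simp [State.init]
  have hT₂ : Table B f L ∅ σ₂.poly := by
    subst e₂; subst e₁
    exact ⟨rfl, fun i u _ => by simp [State.init, distribution]⟩
  refine Exec.seq ((exec_shortListProg f (le_max_right n L) l (fun π h => (hl π).1 h) hnd ∅
    (by simp) σ₂ hT₂).le (T' := l.length * shortTime s L (n + L) + 1) ?_) fun σ₃ h₃ => ?_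
  · unfold shortTime statTime
    gcongr
  have hT₃ : Table B f L {π | π.length < L} σ₃.poly := h₃.1.congr fun π hπ => by
    simpa [hl] using fun _ => hπ
  refine Exec.seq (((Exec.forLoop (T := nestTime s L tree.depth (n + L) L) (a := L - 1) (b := n)
    (fun x σ' => σ'.int (regV 0) = x ∧ σ'.int (-16) = n ∧
      Table B f L {π | π.length < x + 1} σ'.poly) (by omega) (h16 0).symm (h₃.2.trans h₂)
        (fun k σ h => ⟨h.1, h.2.1⟩) ?_ ?_ ?_).le ?_)) fun σ₄ h₄ => ?_
  · rintro x σ' c ⟨h1, h2, h3⟩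
    exact ⟨by simp [h1, show regV 0 ≠ -9 by omega], by simp [h2], h3⟩
  · rintro x σ' hax hxb ⟨h1, h2, h3⟩
    have key := exec_nestProg (B := B) f (n := max n L) (j := x + 1) tree (by omega) (by omega)
      (fun v hv hv' => htree (x + 1) v (by omega) hv hv') L [] (by simp) (by simp)
      {π | π.length < x + 1} (fun π hπ h => by
        have h4 : π.length < x + 1 := hπ
        have := h.1
        omega) (fun π hπ => hπ) ((σ'.setInt (-3) 1).setInt (regV 0) (x + 1 : ℕ))
      (.cons ⟨regV_le 0, by simp⟩ .nil) h3
    refine key.weaken ?_ fun σ'' h => ⟨?_, ?_, h.1.congr fun π _ => ?_⟩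
    · exact nestTime_mono s L tree.depth L hle
    · rw [h.2 _ (regV_le 0) (by unfold regV; omega) (by unfold regV; simp)]
      simp
    · rw [h.2 _ (by norm_num) (by norm_num) (by unfold regV; simp)]
      simp [h16 0, h2]
    · simp only [Set.mem_union, Set.mem_ofPred_eq, List.length_nil, List.take_zero, and_true]
      omega
  · refine ⟨by simp, ?_, hT₃.congr fun π _ => ?_⟩
    · simp [h16 0, h₃.2, h₂]
    · simp only [Set.mem_ofPred_eq]
      omega
  · gcongr
    omega
  refine ((exec_encProg f _ (n + L) σ₄ [-16] [n] (.cons ⟨by norm_num, h₄.2.1⟩ .nil) (by simp)).le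
    (T' := 1 * ((n + L) * 3 + 6) + 1) (by simp)).seq fun σ₅ h₅ =>
      Exec.seq (T := 1) (Exec.const rfl) fun σ₆ h₆ => ?_
  subst h₆
  have hT₅ := h₄.2.2
  rw [← h₅.1.1] at hT₅
  -- Cell `0` still holds zero, so this addition copies the entry for length `n` and the empty
  -- prefix, whose cylinder is all of `S_n(B)`.
  refine Exec.polyAdd ?_ ?_ ?_
  · simp only [State.setInt_int, State.setInt_poly]
    norm_num
    rw [h₅.2]
    exact hT₅.terms_le (le_max_left n L) (by simp)
  · simp only [State.setInt_int, State.setInt_poly, if_true]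
    rw [hT₅.1]
    simp [terms]
  · simp only [State.setInt_int, State.setInt_poly, if_true, State.setPoly_poly]
    norm_num
    rw [h₅.2, hT₅.1, hT₅.2 n [] (by simp), add_zero]
    congr 1
    ext π
    simp only [cylinder, Finset.mem_filter, Set.mem_ofPred_eq, List.length_nil, List.take_zero,
      and_true, and_iff_left_iff_imp, mem_avoiders]
    omega

/-! ### Words with the same order of letters -/

/-- The letters of `u` and `v` are in the same relative order. -/
def SameOrder (u v : List ℕ) : Prop :=
  u.length = v.length ∧ ∀ a b, a < u.length → b < u.length →
    (u.getD a 0 ≤ u.getD b 0 ↔ v.getD a 0 ≤ v.getD b 0)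

theorem map_getD_range (u : List ℕ) : (List.range u.length).map (u.getD · 0) = u := by
  apply List.ext_getElem (by simp)
  intro i h1 h2
  simp [h2]

theorem SameOrder.symm {u v : List ℕ} (h : SameOrder u v) : SameOrder v u :=
  ⟨h.1.symm, fun a b ha hb => (h.2 a b (h.1 ▸ ha) (h.1 ▸ hb)).symm⟩

theorem SameOrder.select {u v : List ℕ} (h : SameOrder u v) {I : List ℕ}
    (hI : ∀ i ∈ I, i < u.length) : SameOrder (I.map (u.getD · 0)) (I.map (v.getD · 0)) := by
  refine ⟨by simp, fun a b ha hb => ?_⟩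
  rw [List.length_map] at ha hb
  have := h.2 I[a] I[b] (hI _ (List.getElem_mem _)) (hI _ (List.getElem_mem _))
  rw [List.getD_eq_getElem _ _ (by simpa using ha), List.getD_eq_getElem _ _ (by simpa using hb),
    List.getD_eq_getElem (I.map _) _ (by simpa using ha),
    List.getD_eq_getElem (I.map _) _ (by simpa using hb)]
  simpa only [List.getElem_map] using this

theorem map_getD_range_take (u : List ℕ) {k : ℕ} (hk : k ≤ u.length) :
    (List.range k).map (u.getD · 0) = u.take k := by
  conv_rhs => rw [← map_getD_range u]
  rw [← List.map_take, List.take_range, min_eq_left hk]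

theorem SameOrder.take {u v : List ℕ} (h : SameOrder u v) {k : ℕ} (hk : k ≤ u.length) :
    SameOrder (u.take k) (v.take k) := by
  rw [← map_getD_range_take u hk, ← map_getD_range_take v (h.1 ▸ hk)]
  exact h.select fun i hi => by rw [List.mem_range] at hi; omega

theorem card_filter_le_eq_countP {w : List ℕ} (hw : w.Nodup) (a : ℕ) :
    (w.toFinset.filter (· ≤ a)).card = w.countP (· ≤ a) := by
  rw [List.countP_eq_length_filter, ← List.toFinset_card_of_nodup (hw.filter _),
    List.toFinset_filter]
  simp

theorem red_eq_map_countP {w : List ℕ} (hw : w.Nodup) :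
    red w = w.map fun a => w.countP (· ≤ a) :=
  List.map_congr_left fun a _ => card_filter_le_eq_countP hw a

/-- Counting positions instead of letters shows that the reduction depends only on the comparisons
between letters. -/
theorem red_eq_map_range {w : List ℕ} (hw : w.Nodup) :
    red w = (List.range w.length).map fun a =>
      (List.range w.length).countP fun b => w.getD b 0 ≤ w.getD a 0 := by
  rw [red_eq_map_countP hw]
  conv_lhs => rw [← map_getD_range w]
  rw [List.map_map]
  refine List.map_congr_left fun a _ => ?_
  rw [Function.comp_apply, List.countP_map]
  rfl

theorem SameOrder.red_eq {u v : List ℕ} (h : SameOrder u v) (hu : u.Nodup) (hv : v.Nodup) :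
    red u = red v := by
  rw [red_eq_map_range hu, red_eq_map_range hv, ← h.1]
  refine List.map_congr_left fun a ha => List.countP_congr fun b hb => ?_
  rw [List.mem_range] at ha hb
  simpa using h.2 b a hb ha

theorem length_red (w : List ℕ) : (red w).length = w.length := by simp [red]

theorem sameOrder_red (w : List ℕ) : SameOrder w (red w) := by
  refine ⟨(length_red w).symm, fun a b ha hb => ?_⟩
  have key : ∀ {a : ℕ} (ha : a < w.length),
      (red w).getD a 0 = (w.toFinset.filter (· ≤ w[a])).card := by
    intro a ha
    rw [List.getD_eq_getElem _ _ (by rwa [length_red])]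
    simp [red]
  rw [key ha, key hb, List.getD_eq_getElem _ _ ha, List.getD_eq_getElem _ _ hb]
  refine ⟨fun h => Finset.card_le_card fun x hx => ?_, fun h => ?_⟩
  · rw [Finset.mem_filter] at hx ⊢
    exact ⟨hx.1, hx.2.trans h⟩
  · by_contra hlt
    refine absurd h (not_le.2 (Finset.card_lt_card ?_))
    rw [Finset.ssubset_iff_of_subset]
    · exact ⟨w[a], by simp, by simpa using hlt⟩
    · intro x hx
      rw [Finset.mem_filter] at hx ⊢
      exact ⟨hx.1, by omega⟩

theorem nodup_red {w : List ℕ} (hw : w.Nodup) : (red w).Nodup := (isPermutation_red hw).nodup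

theorem red_take_red {w : List ℕ} (hw : w.Nodup) {k : ℕ} (hk : k ≤ w.length) :
    red ((red w).take k) = red (w.take k) :=
  (((sameOrder_red w).take hk).red_eq (hw.sublist (List.take_sublist _ _))
    ((nodup_red hw).sublist (List.take_sublist _ _))).symm

/-! ### Deletions -/

theorem lettersAt_eq_map (P : ℕ → Prop) [DecidablePred P] (w : List ℕ) :
    lettersAt P w = ((List.range w.length).filter fun i => P (i + 1)).map (w.getD · 0) := by
  have h : w.zipIdx 1 = (List.range w.length).map fun i => (w.getD i 0, i + 1) := by
    apply List.ext_getElem (by simp)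
    intro i h1 h2
    have : i < w.length := by simpa using h1
    simp [this, add_comm]
  rw [lettersAt, h, List.filter_map, List.map_map]
  rfl

theorem SameOrder.lettersAt {u v : List ℕ} (h : SameOrder u v) (P : ℕ → Prop)
    [DecidablePred P] : SameOrder (EnumScheme.lettersAt P u) (EnumScheme.lettersAt P v) := by
  rw [lettersAt_eq_map, lettersAt_eq_map, ← h.1]
  exact h.select fun i hi => by simpa using (List.mem_filter.1 hi).1

theorem mem_of_mem_lettersAt {P : ℕ → Prop} [DecidablePred P] {w : List ℕ} {a : ℕ}
    (h : a ∈ lettersAt P w) : a ∈ w := by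
  have hs : (lettersAt P w).Sublist ((w.zipIdx 1).map Prod.fst) :=
    List.Sublist.map Prod.fst List.filter_sublist
  rw [List.zipIdx_map_fst] at hs
  exact hs.subset h

theorem lettersAt_perm (R : Finset ℕ) (w : List ℕ) :
    (lettersAt (· ∈ R) w ++ lettersAt (· ∉ R) w).Perm w := by
  have h := (List.filter_append_perm (fun x : ℕ × ℕ => decide (x.2 ∈ R)) (w.zipIdx 1)).map Prod.fst
  rw [List.map_append, List.zipIdx_map_fst] at h
  refine List.Perm.trans (List.Perm.of_eq ?_) h
  simp [lettersAt]

theorem not_mem_lettersAt {R : Finset ℕ} {w : List ℕ} (hw : w.Nodup) {a : ℕ}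
    (ha : a ∈ lettersAt (· ∉ R) w) : a ∉ lettersAt (· ∈ R) w := fun h =>
  (List.nodup_append.1 ((lettersAt_perm R w).nodup_iff.2 hw)).2.2 a h a ha rfl

theorem lettersAt_append_of_subset {R : Finset ℕ} {u x : List ℕ}
    (hR : R ⊆ Finset.Icc 1 u.length) :
    lettersAt (· ∈ R) (u ++ x) = lettersAt (· ∈ R) u ∧
      lettersAt (· ∉ R) (u ++ x) = lettersAt (· ∉ R) u ++ x := by
  have h : ∀ y ∈ x.zipIdx (1 + u.length), y.2 ∉ R := by
    intro y hy hyR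
    have h1 := List.le_snd_of_mem_zipIdx hy
    have h2 := Finset.mem_Icc.1 (hR hyR)
    omega
  constructor
  · rw [lettersAt, List.zipIdx_append, List.filter_append, List.map_append,
      List.filter_eq_nil_iff (l := x.zipIdx _).2 fun y hy => by simpa using h y hy]
    simp [lettersAt]
  · rw [lettersAt, List.zipIdx_append, List.filter_append, List.map_append,
      List.filter_eq_self (l := x.zipIdx _).2 fun y hy => by simpa using h y hy,
      List.zipIdx_map_fst]
    simp [lettersAt]

theorem length_lettersAt_mem {R : Finset ℕ} {w : List ℕ} (hR : R ⊆ Finset.Icc 1 w.length) :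
    (lettersAt (· ∈ R) w).length = R.card := by
  rw [lettersAt_eq_map, List.length_map, ← List.toFinset_card_of_nodup (List.nodup_range.filter _)]
  refine Finset.card_bij (fun i _ => i + 1) (fun i hi => ?_) (fun i _ k _ h => by omega)
    fun i hi => ⟨i - 1, ?_, ?_⟩
  · simpa using (List.mem_filter.1 (List.mem_toFinset.1 hi)).2
  · have := Finset.mem_Icc.1 (hR hi)
    simp only [List.toFinset_filter, Finset.mem_filter, List.mem_toFinset, List.mem_range,
      decide_eq_true_eq]
    rw [Nat.sub_add_cancel this.1]
    exact ⟨by omega, hi⟩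
  · have := Finset.mem_Icc.1 (hR hi)
    omega

theorem length_deleteWord {R : Finset ℕ} {w : List ℕ} (hR : R ⊆ Finset.Icc 1 w.length) :
    (deleteWord R w).length = w.length - R.card := by
  have h1 := (lettersAt_perm R w).length_eq
  rw [List.length_append, length_lettersAt_mem hR] at h1
  rw [deleteWord, List.length_map]
  omega

theorem deleteWord_append {R : Finset ℕ} {u x : List ℕ} (hR : R ⊆ Finset.Icc 1 u.length) :
    deleteWord R (u ++ x) = deleteWord R u ++
      x.map fun a => a - (lettersAt (· ∈ R) u).countP (· < a) := by
  obtain ⟨h1, h2⟩ := lettersAt_append_of_subset (x := x) hR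
  rw [deleteWord, h1, h2, List.map_append, deleteWord]

theorem deleteWord_take {R : Finset ℕ} {w : List ℕ} {k : ℕ} (hR : R ⊆ Finset.Icc 1 k)
    (hk : k ≤ w.length) : (deleteWord R w).take (k - R.card) = deleteWord R (w.take k) := by
  have hl : (w.take k).length = k := by simp [hk]
  have hR' : R ⊆ Finset.Icc 1 (w.take k).length := by rwa [hl]
  conv_lhs => rw [← List.take_append_drop k w, deleteWord_append hR']
  rw [List.take_left' (by rw [length_deleteWord hR', hl])]

/-! ### The relabelling of the letters that survive a deletion -/

theorem countP_lt_add_one_le {l : List ℕ} (hl : l.Nodup) (h1 : ∀ x ∈ l, 1 ≤ x) {a : ℕ}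
    (ha : 1 ≤ a) : l.countP (· < a) + 1 ≤ a := by
  rw [List.countP_eq_length_filter, ← List.toFinset_card_of_nodup (hl.filter _)]
  have : (l.filter (· < a)).toFinset ⊆ Finset.Ico 1 a := by
    intro x hx
    simp only [List.toFinset_filter, Finset.mem_filter, List.mem_toFinset,
      decide_eq_true_eq] at hx
    exact Finset.mem_Ico.2 ⟨h1 x hx.1, hx.2⟩
  have := Finset.card_le_card this
  rw [Nat.card_Ico] at this
  omega

/-- As `a ∉ l`, at most `b - a - 1` deleted letters lie in `[a, b)`, so the distance from `a` to `b`
cannot shrink to zero. -/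
theorem sub_countP_lt {l : List ℕ} (hl : l.Nodup) (h1 : ∀ x ∈ l, 1 ≤ x) {a b : ℕ}
    (hab : a < b) (ha1 : 1 ≤ a) (ha : a ∉ l) :
    a - l.countP (· < a) < b - l.countP (· < b) := by
  have ha' := countP_lt_add_one_le hl h1 ha1
  have hb' := countP_lt_add_one_le hl h1 (ha1.trans hab.le)
  have : l.countP (· < b) ≤ l.countP (· < a) + (b - a - 1) := by
    rw [List.countP_eq_length_filter, List.countP_eq_length_filter,
      ← List.toFinset_card_of_nodup (hl.filter _), ← List.toFinset_card_of_nodup (hl.filter _),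
      ← Nat.card_Ioo]
    refine (Finset.card_le_card fun x hx => ?_).trans (Finset.card_union_le _ _)
    simp only [List.toFinset_filter, Finset.mem_filter, List.mem_toFinset, decide_eq_true_eq,
      Finset.mem_union, Finset.mem_Ioo] at hx ⊢
    have : x ≠ a := fun h => ha (h ▸ hx.1)
    rcases Nat.lt_or_ge x a with h | h
    · exact Or.inl ⟨hx.1, h⟩
    · exact Or.inr ⟨by omega, hx.2⟩
  omega

/-- In a permutation exactly `a` letters are at most `a`; taking away the deleted ones leaves the
rank of `a` among the remaining letters. -/
theorem deletePerm_val (R : Finset ℕ) (π : Permutation) :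
    (deletePerm R π).1 = deleteWord R π.1 := by
  have hnd := π.2.nodup
  change red (lettersAt (· ∉ R) π.1) = _
  rw [red_eq_map_countP (nodup_lettersAt _ hnd), deleteWord]
  refine List.map_congr_left fun a ha => ?_
  have haπ := π.isInjWord.2 a (mem_of_mem_lettersAt ha)
  have h1 := (lettersAt_perm R π.1).countP_eq (fun x => decide (x ≤ a))
  rw [List.countP_append, List.Perm.countP_eq _ π.2] at h1
  have h2 : (List.range' 1 π.1.length).countP (fun x => decide (x ≤ a)) = a := by
    rw [List.countP_eq_length_filter,
      ← List.toFinset_card_of_nodup ((List.nodup_range' (step := 1)).filter _)]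
    have : ((List.range' 1 π.1.length).filter (fun x => decide (x ≤ a))).toFinset =
        Finset.Icc 1 a := by
      ext x
      simp only [List.toFinset_filter, Finset.mem_filter, List.mem_toFinset, List.mem_range'_1,
        decide_eq_true_eq, Finset.mem_Icc]
      have : π.length = π.1.length := rfl
      omega
    rw [this, Nat.card_Icc, Nat.add_sub_cancel]
  have h3 : (lettersAt (· ∈ R) π.1).countP (fun x => decide (x ≤ a)) =
      (lettersAt (· ∈ R) π.1).countP (fun x => decide (x < a)) := by
    refine List.countP_congr fun x hx => ?_
    have : x ≠ a := fun h => not_mem_lettersAt hnd ha (h ▸ hx)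
    simp only [decide_eq_true_eq]
    omega
  rw [h2, h3] at h1
  omega

theorem length_deletePerm {R : Finset ℕ} {π : Permutation} (hR : R ⊆ Finset.Icc 1 π.length) :
    (deletePerm R π).length = π.length - R.card := by
  change (deletePerm R π).1.length = _
  rw [deletePerm_val, length_deleteWord hR]
  rfl

/-- All deleted letters lie in the common part `u`, so both tails undergo the same relabelling,
which is strictly increasing away from the deleted letters. -/
theorem eq_of_deleteWord_eq {R : Finset ℕ} {u x x' : List ℕ} (hR : R ⊆ Finset.Icc 1 u.length)
    (h1 : ∀ a ∈ u ++ x ++ x', 1 ≤ a) (hx : (u ++ x).Nodup) (hx' : (u ++ x').Nodup)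
    (h : deleteWord R (u ++ x) = deleteWord R (u ++ x')) : x = x' := by
  rw [deleteWord_append hR, deleteWord_append hR] at h
  replace h := List.append_cancel_left h
  set l := lettersAt (· ∈ R) u with hl
  have hlu : ∀ a ∈ l, a ∈ u := fun a ha => mem_of_mem_lettersAt ha
  have hlnd : l.Nodup := nodup_lettersAt _ (List.nodup_append.1 hx).1
  have hl1 : ∀ a ∈ l, 1 ≤ a := fun a ha => h1 a (by simp [hlu a ha])
  have hxl : ∀ a ∈ x, a ∉ l ∧ 1 ≤ a := fun a ha => ⟨fun hal =>
    (List.nodup_append.1 hx).2.2 a (hlu a hal) a ha rfl, h1 a (by simp [ha])⟩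
  have hxl' : ∀ a ∈ x', a ∉ l ∧ 1 ≤ a := fun a ha => ⟨fun hal =>
    (List.nodup_append.1 hx').2.2 a (hlu a hal) a ha rfl, h1 a (by simp [ha])⟩
  clear_value l
  clear h1 hx hx' hl
  induction x generalizing x' with
  | nil => cases x' <;> simp_all
  | cons a x ih =>
    cases x' with
    | nil => simp at h
    | cons b x' =>
      simp only [List.map_cons, List.cons.injEq] at h
      simp only [List.forall_mem_cons] at hxl hxl'
      have hab : a = b := by
        rcases Nat.lt_trichotomy a b with hab | hab | hab
        · exact absurd h.1 (sub_countP_lt hlnd hl1 hab hxl.1.2 hxl.1.1).ne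
        · exact hab
        · exact absurd h.1 (sub_countP_lt hlnd hl1 hab hxl'.1.2 hxl'.1.1).ne'
      rw [hab, ih h.2 hxl.2 hxl'.2]

theorem IsInjWord.of_prefix {π : Permutation} {v x : List ℕ} (h : π.1 = v ++ x) :
    IsInjWord π.length v :=
  ⟨(List.nodup_append.1 (h ▸ π.2.nodup)).1, fun a ha => π.isInjWord.2 a (by simp [h, ha])⟩

/-- The relabelling preserves order, so the tail stays increasing, and a permutation is determined
by a prefix and the fact that the rest increases. Hence one subroutine evaluates the statistics
before and after the deletion, knowing only the two words. -/
theorem deletePerm_extPerm {R : Finset ℕ} {j : ℕ} {v : List ℕ} (hv : IsInjWord j v)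
    (hR : R ⊆ Finset.Icc 1 v.length) (hvj : v.length ≤ j) :
    ∃ h : IsInjWord (j - R.card) (deleteWord R v),
      deletePerm R (extPerm j v hv) = extPerm (j - R.card) (deleteWord R v) h := by
  have hlen := length_extPerm hv
  have hval : (deletePerm R (extPerm j v hv)).1 = deleteWord R v ++
      ((List.range' 1 j).filter (· ∉ v)).map
        fun a => a - (lettersAt (· ∈ R) v).countP (· < a) := by
    rw [deletePerm_val]
    exact deleteWord_append hR
  have hlen' : (deletePerm R (extPerm j v hv)).length = j - R.card := by
    rw [length_deletePerm, hlen]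
    rw [hlen]
    exact hR.trans (Finset.Icc_subset_Icc_right hvj)
  have hinj : IsInjWord (j - R.card) (deleteWord R v) := hlen' ▸ IsInjWord.of_prefix hval
  refine ⟨hinj, Subtype.ext ?_⟩
  rw [hval]
  change _ = ext _ _
  have hperm := (deletePerm R (extPerm j v hv)).2
  unfold IsPermutation at hperm
  rw [show (deletePerm R (extPerm j v hv)).1.length = j - R.card from hlen', hval] at hperm
  have hperm' := hperm.trans (ext_perm hinj).symm
  unfold ext at hperm' ⊢
  rw [List.perm_append_left_iff] at hperm'
  congr 1
  refine List.Perm.eq_of_pairwise' (r := (· ≤ ·)) ?_ ?_ hperm'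
  · rw [List.pairwise_map]
    refine List.Pairwise.imp_of_mem (R := (· < ·)) ?_
      (List.Pairwise.filter _ List.pairwise_lt_range')
    intro a b ha _ hab
    simp only [List.mem_filter, List.mem_range'_1, decide_eq_true_eq] at ha
    exact (sub_countP_lt (nodup_lettersAt _ hv.1)
      (fun x hx => (hv.2 x (mem_of_mem_lettersAt hx)).1) hab ha.1.1
      fun h => ha.2 (mem_of_mem_lettersAt h)).le
  · exact List.Pairwise.filter _ ((List.pairwise_lt_range' (step := 1)).imp fun h => h.le)

/-! ### Existence of decision trees -/

/-- Branch on the tests one after another; when none is left, `F` is constant on the remaining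
inputs. How to find the labels is irrelevant, since only the existence of a fixed tree is needed. -/
theorem DTree.exists_eval_eq {d : ℕ} {α X : Type} [Inhabited α] (ρ : X → Fin d → ℤ) (F : X → α)
    (tests : List (Fin d × Fin d × ℤ)) (dom : Set X)
    (h : ∀ x ∈ dom, ∀ y ∈ dom, (∀ a ∈ tests,
      (ρ x a.1 + a.2.2 < ρ x a.2.1 ↔ ρ y a.1 + a.2.2 < ρ y a.2.1)) → F x = F y) :
    ∃ t : DTree d α, ∀ x ∈ dom, t.eval (ρ x) = F x := by
  classical
  induction tests generalizing dom with
  | nil =>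
    by_cases hd : dom.Nonempty
    · obtain ⟨x, hx⟩ := hd
      exact ⟨.leaf (F x), fun y hy => h x hx y hy (by simp)⟩
    -- No input from `dom` reaches this leaf.
    · exact ⟨.leaf default, fun y hy => (hd ⟨y, hy⟩).elim⟩
  | cons a tests ih =>
    obtain ⟨t₁, h₁⟩ := ih {x | x ∈ dom ∧ ρ x a.1 + a.2.2 < ρ x a.2.1} fun x hx y hy hxy =>
      h x hx.1 y hy.1 fun b hb => (List.mem_cons.1 hb).elim
        (fun e => e ▸ iff_of_true hx.2 hy.2) (hxy b)
    obtain ⟨t₂, h₂⟩ := ih {x | x ∈ dom ∧ ¬ ρ x a.1 + a.2.2 < ρ x a.2.1} fun x hx y hy hxy =>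
      h x hx.1 y hy.1 fun b hb => (List.mem_cons.1 hb).elim
        (fun e => e ▸ iff_of_false hx.2 hy.2) (hxy b)
    refine ⟨.node a.1 a.2.1 a.2.2 t₁ t₂, fun x hx => ?_⟩
    rw [DTree.eval]
    split_ifs with hc
    · exact h₁ x ⟨hx, hc⟩
    · exact h₂ x ⟨hx, hc⟩

/-- By Dickson's lemma, membership in an upper set of vectors of natural numbers depends only on
the components up to some threshold. -/
theorem exists_threshold {d : ℕ} (U : Set (Fin d → ℕ)) (hU : IsUpperSet U) :
    ∃ M, ∀ x y, (∀ i, ∀ c ≤ M, c ≤ x i → c ≤ y i) → x ∈ U → y ∈ U := by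
  have hfin : {x | Minimal (· ∈ U) x}.Finite :=
    WellQuasiOrderedLE.finite_of_isAntichain (setOfPred_minimal_antichain _)
  -- The threshold is the largest component of a minimal element. Some minimal `g` lies below `x`,
  -- and its components are within the threshold, so `g` lies below `y` too.
  refine ⟨hfin.toFinset.sup fun g => Finset.univ.sup g, fun x y hxy hx => ?_⟩
  obtain ⟨g, hgx, hg⟩ := (Set.isPWO_of_wellQuasiOrderedLE U).exists_le_minimal hx
  refine hU (fun i => hxy i (g i) ?_ (hgx i)) hg.1
  exact (Finset.le_sup (f := g) (Finset.mem_univ i)).trans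
    (Finset.le_sup (f := fun g : Fin d → ℕ => Finset.univ.sup g) (hfin.mem_toFinset.2 hg))

/-! ### What the deletion rule for a word depends on -/

/-- The differences of the numbers `ρ` and those of the numbers `ρ'` agree up to `M`. -/
def Agree {d : ℕ} (M : ℕ) (ρ ρ' : Fin d → ℤ) : Prop :=
  ∀ x y, ∀ c : ℤ, -(M + 1) ≤ c → c ≤ M + 1 → (ρ x + c < ρ y ↔ ρ' x + c < ρ' y)

/-- The tests that decide whether differences agree up to `M`. -/
noncomputable def agreeTests (d M : ℕ) : List (Fin d × Fin d × ℤ) :=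
  (Finset.univ ×ˢ Finset.univ ×ˢ Finset.Icc (-(M + 1) : ℤ) (M + 1)).toList

theorem agree_of_tests {d M : ℕ} {ρ ρ' : Fin d → ℤ} (h : ∀ a ∈ agreeTests d M,
    (ρ a.1 + a.2.2 < ρ a.2.1 ↔ ρ' a.1 + a.2.2 < ρ' a.2.1)) : Agree M ρ ρ' := fun x y c h1 h2 =>
  h (x, y, c) (by
    simp only [agreeTests, Finset.mem_toList, Finset.mem_product, Finset.mem_univ, true_and,
      Finset.mem_Icc]
    exact ⟨h1, h2⟩)

theorem Agree.sameOrder {L M j j' : ℕ} {v v' : List ℕ} (hv : v.length = L) (hv' : v'.length = L)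
    (h : Agree M (env (L + 2) j v) (env (L + 2) j' v')) : SameOrder v v' := by
  refine ⟨hv.trans hv'.symm, fun a b ha hb => ?_⟩
  have := h ⟨b + 2, by omega⟩ ⟨a + 2, by omega⟩ 0 (by omega) (by omega)
  simp only [env, List.getD_cons_succ, add_zero, Nat.cast_lt] at this
  omega

theorem SameOrder.nodup {u v : List ℕ} (h : SameOrder u v) (hu : u.Nodup) : v.Nodup := by
  rw [List.nodup_iff_injective_getElem] at hu ⊢
  rintro ⟨a, ha⟩ ⟨b, hb⟩ hab
  have ha' := h.1 ▸ ha
  have hb' := h.1 ▸ hb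
  have h1 := h.2 a b ha' hb'
  have h2 := h.2 b a hb' ha'
  rw [List.getD_eq_getElem _ _ ha, List.getD_eq_getElem _ _ hb, List.getD_eq_getElem _ _ ha',
    List.getD_eq_getElem _ _ hb'] at h1 h2
  have hab' : v[a] = v[b] := hab
  have := @hu ⟨a, ha'⟩ ⟨b, hb'⟩ (by change u[a] = u[b]; omega)
  simpa using this

/-- Sorting positions by their letters gives one list of positions that sorts both words. -/
theorem SameOrder.exists_sort {v v' : List ℕ} (h : SameOrder v v') {k : ℕ} (hk : k ≤ v.length) :
    ∃ I : List ℕ, (∀ i ∈ I, i < v.length) ∧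
      (v.take k).insertionSort (· ≤ ·) = I.map (v.getD · 0) ∧
      (v'.take k).insertionSort (· ≤ ·) = I.map (v'.getD · 0) := by
  refine ⟨(List.range k).insertionSort fun a b => v.getD a 0 ≤ v.getD b 0, fun i hi => ?_, ?_, ?_⟩
  · rw [List.mem_insertionSort, List.mem_range] at hi
    omega
  · rw [← map_getD_range_take v hk]
    exact (List.map_insertionSort (fun a b => v.getD a 0 ≤ v.getD b 0) (· ≤ ·) _ _ fun a _ b _ => Iff.rfl).symm
  · rw [← map_getD_range_take v' (h.1 ▸ hk)]
    refine (List.map_insertionSort (fun a b => v.getD a 0 ≤ v.getD b 0) (· ≤ ·) _ _ fun a ha b hb => ?_).symm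
    rw [List.mem_range] at ha hb
    exact h.2 a b (by omega) (by omega)

/-- The list `0 :: (I.map (· + 2) ++ [1])` names the entries of `env` that play the roles of `c₀, …,
c_{k+1}`. Since `env` holds `n` where the spacing vector uses `n + 1`, index `1` needs a correction
by one. The case `c = 0` is separate because of truncated subtraction. -/
theorem le_spacing_iff {L n k : ℕ} {v I : List ℕ} (hI : ∀ i ∈ I, i < L)
    (hs : (v.take k).insertionSort (· ≤ ·) = I.map (v.getD · 0)) (i : Fin (k + 1)) (c : ℕ) :
    c ≤ spacing n k (v.take k) i ↔ c = 0 ∨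
      (env (L + 2) n v (Fin.ofNat (L + 2) ((0 :: (I.map (· + 2) ++ [1])).getD i 0)) +
        (c + (if (0 :: (I.map (· + 2) ++ [1])).getD i 0 = 1 then 1 else 0) -
          (if (0 :: (I.map (· + 2) ++ [1])).getD (i + 1) 0 = 1 then 1 else 0)) <
      env (L + 2) n v (Fin.ofNat (L + 2) ((0 :: (I.map (· + 2) ++ [1])).getD (i + 1) 0))) := by
  set e : ℕ → ℕ := fun x => (0 :: (n + 1) :: v).getD x 0 with he
  have hmap : 0 :: ((v.take k).insertionSort (· ≤ ·) ++ [n + 1]) =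
      (0 :: (I.map (· + 2) ++ [1])).map e := by
    rw [hs]
    simp [he, Function.comp_def]
  have hlt : ∀ x, (0 :: (I.map (· + 2) ++ [1])).getD x 0 < L + 2 := by
    intro x
    by_cases hx : x < (0 :: (I.map (· + 2) ++ [1])).length
    · rw [List.getD_eq_getElem _ _ hx]
      have := List.getElem_mem hx
      generalize (0 :: (I.map (· + 2) ++ [1]))[x] = y at this
      simp only [List.mem_cons, List.mem_append, List.mem_map, List.not_mem_nil, or_false] at this
      rcases this with rfl | ⟨z, hz, rfl⟩ | rfl
      · omega
      · have := hI z hz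
        omega
      · omega
    · rw [List.getD_eq_default _ _ (by omega)]
      omega
  have henv : ∀ x < L + 2, (e x : ℤ) = env (L + 2) n v (Fin.ofNat (L + 2) x) + if x = 1 then 1 else 0 := by
    intro x hx
    have : (Fin.ofNat (L + 2) x : ℕ) = x := Nat.mod_eq_of_lt hx
    rw [env, this]
    rcases x with _ | _ | x <;> simp [he]
  have hget : ∀ x, ((0 :: (I.map (· + 2) ++ [1])).map e).getD x 0 =
      e ((0 :: (I.map (· + 2) ++ [1])).getD x 0) := by
    intro x
    have h : ((0 :: (I.map (· + 2) ++ [1])).map e).getD x (e 0) = _ := List.getD_map _ _ e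
    exact h
  have h1 := henv _ (hlt i)
  have h2 := henv _ (hlt (i + 1))
  rw [spacing]
  simp only [hmap, hget]
  generalize (0 :: (I.map (· + 2) ++ [1])).getD i 0 = a at *
  generalize (0 :: (I.map (· + 2) ++ [1])).getD (i + 1) 0 = b at *
  have : c ≤ e b - e a - 1 ↔ c = 0 ∨ (e a : ℤ) + c < e b := by omega
  rw [this, h1, h2]
  refine or_congr_right ?_
  split_ifs <;> omega

/-- The correction for `n + 1` shifts the tested constant by at most one, which is why `Agree`
allows constants up to `M + 1`. -/
theorem Agree.spacing_le {L M j j' k : ℕ} {v v' : List ℕ} (hv : v.length = L)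
    (hv' : v'.length = L) (hk : k ≤ L)
    (h : Agree M (env (L + 2) j v) (env (L + 2) j' v')) (i : Fin (k + 1)) (c : ℕ) (hc : c ≤ M) :
    c ≤ spacing j k (v.take k) i ↔ c ≤ spacing j' k (v'.take k) i := by
  obtain ⟨I, hI, h1, h2⟩ := (h.sameOrder hv hv').exists_sort (k := k) (by omega)
  rw [hv] at hI
  rw [le_spacing_iff hI h1, le_spacing_iff hI h2]
  refine or_congr_right (h _ _ _ ?_ ?_)
  · split_ifs <;> omega
  · split_ifs <;> omega

/-- How the word that arises from the deletion of the letters of `v` at the positions in `R` is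
computed: the first entry belongs to the length of the permutation. -/
def deletionMoves (R : Finset ℕ) (v : List ℕ) : List (ℕ × ℤ) :=
  (0, (R.card : ℤ)) :: ((List.range v.length).filter fun i => i + 1 ∉ R).map fun i =>
    (i + 1, (((List.range v.length).filter fun i => i + 1 ∈ R).countP
      fun b => v.getD b 0 < v.getD i 0 : ℕ))

theorem SameOrder.deletionMoves_eq {u v : List ℕ} (h : SameOrder u v) (R : Finset ℕ) :
    deletionMoves R u = deletionMoves R v := by
  unfold deletionMoves
  rw [← h.1]
  congr 1
  refine List.map_congr_left fun i hi => ?_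
  have hi' := List.mem_range.1 (List.mem_filter.1 hi).1
  congr 2
  refine List.countP_congr fun b hb => ?_
  have hb' := List.mem_range.1 (List.mem_filter.1 hb).1
  have := h.2 i b hi' hb'
  simp only [decide_eq_true_eq]
  omega

theorem moves_deletionMoves {R : Finset ℕ} {j : ℕ} {v : List ℕ} (hv : IsInjWord j v)
    (hR : R.card ≤ j) :
    Moves (deletionMoves R v) (j :: v) ((j - R.card) :: deleteWord R v) := by
  refine .cons ⟨by simp, by simp [hR]⟩ ?_
  rw [deleteWord, lettersAt_eq_map (· ∉ R), List.map_map, List.forall₂_map_left_iff,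
    List.forall₂_map_right_iff, List.forall₂_same]
  intro i hi
  have hi' := List.mem_range.1 (List.mem_filter.1 hi).1
  refine ⟨by simpa using hi', ?_⟩
  have hle := countP_lt_add_one_le (nodup_lettersAt (· ∈ R) hv.1)
    (fun x hx => (hv.2 x (mem_of_mem_lettersAt hx)).1) (hv.2 _ (List.getElem_mem hi')).1
  simp only [List.getD_cons_succ, Function.comp_apply]
  rw [List.getD_eq_getElem _ _ hi']
  have hcount : ((List.range v.length).filter fun i => i + 1 ∈ R).countP
      (fun b => decide (v.getD b 0 < v[i])) = (lettersAt (· ∈ R) v).countP (· < v[i]) := by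
    rw [lettersAt_eq_map, List.countP_map]
    rfl
  rw [hcount]
  omega

/-! ### The deletion rule given by an enumeration scheme -/

/-- The triple `t` applies to the words with reduction `w`. -/
def Applies (E : Set Triple) (K : ℕ) (w : List ℕ) (t : Triple) : Prop :=
  t ∈ E ∧ t.perm.1 = red (w.take t.perm.length) ∧ t.perm.length ≤ K ∧ (t.del ≠ ∅ ∨ 0 ∈ t.gaps)

/-- If no triple applied, closure under children would carry every prefix of `w` into the scheme,
including the one of length `K + 1`. -/
theorem exists_applies {B : Set VincularPattern} {E : Set Triple} (hE : IsEnumerationScheme B E)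
    {K : ℕ} (hK : ∀ t ∈ E, t.perm.length ≤ K) {w : List ℕ} (hw : w.Nodup) (hKw : K < w.length) :
    ∃ t, Applies E K w t := by
  by_contra hcon
  have key : ∀ k ≤ w.length, ∃ t ∈ E, t.perm.1 = red (w.take k) := by
    intro k
    induction k with
    | zero => exact fun _ => ⟨_, hE.root, rfl⟩
    | succ k ih =>
      intro hk
      obtain ⟨t, ht, htp⟩ := ih (by omega)
      have hlen : t.perm.length = k := by
        change t.perm.1.length = k
        rw [htp, length_red, List.length_take]
        omega
      have hnd : (w.take (k + 1)).Nodup := hw.sublist (List.take_sublist _ _)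
      have hnot : ¬ (t.del ≠ ∅ ∨ 0 ∈ t.gaps) := fun h =>
        hcon ⟨t, ht, by rw [hlen, htp], hK t ht, h⟩
      rw [not_or, not_not] at hnot
      have hchild : IsChild ⟨red (w.take (k + 1)), isPermutation_red hnd⟩ t.perm := by
        constructor
        · change (red (w.take (k + 1))).length = _
          rw [length_red, List.length_take, hlen]
          omega
        · rw [hlen, htp]
          change red ((red (w.take (k + 1))).take k) = _
          rw [red_take_red hnd (by rw [List.length_take]; omega), List.take_take,
            min_eq_left (by omega)]
      obtain ⟨t', ht', htp'⟩ := hE.children t ht hnot.1 hnot.2 _ hchild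
      exact ⟨t', ht', by rw [htp']⟩
  obtain ⟨t, ht, htp⟩ := key (K + 1) hKw
  have h1 := hK t ht
  have h2 : t.perm.length = K + 1 := by
    change t.perm.1.length = K + 1
    rw [htp, length_red, List.length_take]
    omega
  omega

open Classical in
/-- The deletion rule for the word `v`, if `T` chooses triples that apply. -/
noncomputable def label (B : Set VincularPattern) (T : List ℕ → Triple) (j : ℕ) (v : List ℕ) :
    Option (List (ℕ × ℤ)) :=
  -- All gap vectors are consulted, not only those in the triple: the deletion map is known to be
  -- bijective only when every one of them fails.
  if v.Nodup ∧ ¬ ∃ g, IsGapVector B (T (red v)).perm g ∧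
    g ≤ spacing j (T (red v)).perm.length (v.take (T (red v)).perm.length)
  then some (deletionMoves (T (red v)).del v) else none

/-- The triple is a function of `red v`, so words with the same order share it; the gap vector
criterion sees the spacing vector only up to the threshold `M`. -/
theorem Agree.label_eq {B : Set VincularPattern} {T : List ℕ → Triple} {L M j j' : ℕ}
    {v v' : List ℕ} (hv : v.length = L) (hv' : v'.length = L)
    (h : Agree M (env (L + 2) j v) (env (L + 2) j' v'))
    (hT : v.Nodup → (T (red v)).perm.length ≤ L ∧ ∀ x y, (∀ i, ∀ c ≤ M, c ≤ x i → c ≤ y i) →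
      (∃ g, IsGapVector B (T (red v)).perm g ∧ g ≤ x) →
        ∃ g, IsGapVector B (T (red v)).perm g ∧ g ≤ y) :
    label B T j v = label B T j' v' := by
  have hso := h.sameOrder hv hv'
  by_cases hnd : v.Nodup
  · have hnd' := hso.nodup hnd
    obtain ⟨h1, h2⟩ := hT hnd
    unfold label
    rw [← hso.red_eq hnd hnd', hso.deletionMoves_eq]
    congr 1
    refine propext (and_congr (iff_of_true hnd hnd') (not_congr ⟨?_, ?_⟩))
    · exact h2 _ _ fun i c hc => (h.spacing_le hv hv' h1 i c hc).1
    · exact h2 _ _ fun i c hc => (h.spacing_le hv hv' h1 i c hc).2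
  · have hnd' : ¬ v'.Nodup := fun h => hnd (hso.symm.nodup h)
    simp only [label, hnd, hnd', false_and, if_false]

/-! ### Transfer of distributions along the deletion bijection -/

theorem monomial_add {s : ℕ} (a b : Fin s → ℤ) :
    (monomial (a + b) : Laurent s) = monomial a * monomial b := by
  simp [monomial, AddMonoidAlgebra.single_mul_single]

/-- The scheme gives a bijection for the short prefix of length `|p|`, while the statistics need a
longer prefix `v`. The further letters of `v` are relabelled injectively, so prescribing them before
deletion amounts to prescribing their images after it. -/
theorem bijOn_cylinder {B : Set VincularPattern} {p : Permutation} {R : Finset ℕ} {j : ℕ}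
    {v : List ℕ} (hv : IsInjWord j v) (hkv : p.length ≤ v.length) (hvj : v.length ≤ j)
    (hp : p.1 = red (v.take p.length)) (hR : R ⊆ Finset.Icc 1 p.length)
    (hbij : Set.BijOn (deletePerm R) (prefixClass j B p (v.take p.length))
      (prefixClass (j - R.card) B (deletePerm R p) (deleteWord R (v.take p.length)))) :
    Set.BijOn (deletePerm R) (cylinder B j v)
      (cylinder B (j - R.card) (deleteWord R v)) := by
  set k := p.length with hk
  have hRv : R ⊆ Finset.Icc 1 v.length := hR.trans (Finset.Icc_subset_Icc_right hkv)
  have hcard : R.card ≤ k := by simpa using Finset.card_le_card hR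
  have hsub : ∀ π ∈ cylinder B j v, π ∈ prefixClass j B p (v.take k) := by
    intro π hπ
    rw [cylinder, Finset.mem_filter] at hπ
    have : π.1.take k = v.take k := by
      conv_rhs => rw [← hπ.2]
      rw [List.take_take, min_eq_left hkv]
    exact ⟨hπ.1, by rw [← hk, this, hp], this⟩
  have htake : ∀ π : Permutation, π.length = j →
      (deletePerm R π).1.take (v.length - R.card) = deleteWord R (π.1.take v.length) := by
    intro π hπ
    rw [deletePerm_val, deleteWord_take hRv]
    change _ ≤ π.length
    omega
  have hlen := length_deleteWord hRv
  refine ⟨fun π hπ => ?_, fun π hπ π' hπ' h => hbij.2.1 (hsub π hπ) (hsub π' hπ') h, ?_⟩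
  · have h1 := (hbij.1 (hsub π hπ)).1
    simp only [cylinder, Finset.coe_filter, Set.mem_ofPred_eq] at hπ ⊢
    refine ⟨h1, ?_⟩
    rw [hlen, htake π (mem_avoiders.1 hπ.1).1, hπ.2]
  · intro π' hπ'
    simp only [cylinder, Finset.coe_filter, Set.mem_ofPred_eq] at hπ'
    have hplen : (deletePerm R p).length = k - R.card := length_deletePerm hR
    have h1 : π'.1.take (k - R.card) = deleteWord R (v.take k) := by
      rw [← deleteWord_take hR hkv]
      conv_rhs => rw [← hπ'.2, hlen]
      rw [List.take_take, min_eq_left (by omega)]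
    -- Deletion commutes with reduction: both sides reduce words whose order is that of the
    -- surviving letters of `v.take k`.
    have hred : red (π'.1.take (deletePerm R p).length) = (deletePerm R p).1 := by
      rw [hplen, h1]
      have hndk : (v.take k).Nodup := hv.1.sublist (List.take_sublist _ _)
      change _ = red (lettersAt (· ∉ R) p.1)
      have hkl : (v.take k).length = k := by simp [hkv]
      have h5 : SameOrder (lettersAt (· ∉ R) (v.take k)) (deleteWord R (v.take k)) := by
        refine ⟨by simp [deleteWord], fun a b ha hb => ?_⟩
        have hl1 : ∀ x ∈ lettersAt (· ∈ R) (v.take k), 1 ≤ x := fun x hx =>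
          (hv.2 x (List.mem_of_mem_take (mem_of_mem_lettersAt hx))).1
        have hl2 := nodup_lettersAt (· ∈ R) hndk
        have hx : ∀ x ∈ lettersAt (· ∉ R) (v.take k),
            1 ≤ x ∧ x ∉ lettersAt (· ∈ R) (v.take k) := fun x hx =>
          ⟨(hv.2 x (List.mem_of_mem_take (mem_of_mem_lettersAt hx))).1,
            not_mem_lettersAt hndk hx⟩
        have hga : a < (deleteWord R (v.take k)).length := by simpa [deleteWord] using ha
        have hgb : b < (deleteWord R (v.take k)).length := by simpa [deleteWord] using hb
        rw [List.getD_eq_getElem _ _ ha, List.getD_eq_getElem _ _ hb,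
          List.getD_eq_getElem _ _ hga, List.getD_eq_getElem _ _ hgb]
        simp only [deleteWord, List.getElem_map]
        have hxa := hx _ (List.getElem_mem ha)
        have hxb := hx _ (List.getElem_mem hb)
        generalize (lettersAt (· ∉ R) (v.take k))[a] = x at *
        generalize (lettersAt (· ∉ R) (v.take k))[b] = y at *
        rcases Nat.lt_trichotomy x y with h | h | h
        · have := sub_countP_lt hl2 hl1 h hxa.1 hxa.2
          omega
        · simp [h]
        · have := sub_countP_lt hl2 hl1 h hxb.1 hxb.2
          omega
      have h6 := (sameOrder_red (v.take k)).lettersAt (· ∉ R)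
      rw [← hp] at h6
      rw [← h5.red_eq (nodup_lettersAt _ hndk) (h5.nodup (nodup_lettersAt _ hndk)),
        h6.red_eq (nodup_lettersAt _ hndk) (nodup_lettersAt _ p.2.nodup)]
    obtain ⟨π, hπ, rfl⟩ := hbij.2.2 (show π' ∈ prefixClass (j - R.card) B (deletePerm R p)
      (deleteWord R (v.take k)) from ⟨hπ'.1, hred, by rw [hplen, h1]⟩)
    refine ⟨π, ?_, rfl⟩
    simp only [cylinder, Finset.coe_filter, Set.mem_ofPred_eq]
    have hπj := (mem_avoiders.1 hπ.1).1
    refine ⟨hπ.1, ?_⟩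
    have h2 := hπ'.2
    rw [hlen, htake π hπj] at h2
    -- The preimage begins with `v.take k` by construction; its next letters are recovered from
    -- their images.
    have h3 : π.1.take v.length = v.take k ++ (π.1.take v.length).drop k := by
      conv_lhs => rw [← List.take_append_drop k (π.1.take v.length)]
      rw [List.take_take, min_eq_left hkv]
      congr 1
      exact hπ.2.2
    have h4 : v = v.take k ++ v.drop k := (List.take_append_drop k v).symm
    have hkl : (v.take k).length = k := by simp [hkv]
    rw [h3]
    conv_rhs => rw [h4]
    congr 1
    rw [h3] at h2
    conv_rhs at h2 => rw [h4]
    have hnd : (v.take k ++ (π.1.take v.length).drop k).Nodup :=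
      h3 ▸ π.2.nodup.sublist (List.take_sublist _ _)
    refine eq_of_deleteWord_eq (by rwa [hkl]) ?_ hnd (h4 ▸ hv.1) h2
    intro a ha
    rw [← h3, List.mem_append] at ha
    rcases ha with ha | ha
    · exact (π.isInjWord.2 a (List.mem_of_mem_take ha)).1
    · exact (hv.2 a (List.mem_of_mem_drop ha)).1

/-- Each `π` in the cylinder shares its length and its first `K + 1 + m` letters with `extPerm j v
hv`, so compatibility gives both the same change under deletion. This comparison does not require
`extPerm j v hv` to avoid `B`. -/
theorem labelCorrect_label {B : Set VincularPattern} {E : Set Triple}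
    (hE : IsEnumerationScheme B E) {K m s : ℕ} {T : List ℕ → Triple}
    (f : Fin s → Permutation → ℤ) (hf : ∀ i, ESCompatible (f i) m) {j : ℕ} {v : List ℕ}
    (hL : v.length = K + 1 + m) (hLj : v.length ≤ j) (hvj : ∀ x ∈ v, 1 ≤ x ∧ x ≤ j)
    (hT : v.Nodup → Applies E K (red v) (T (red v))) :
    LabelCorrect B f j v (label B T j v) := by
  by_cases hnd : v.Nodup
  swap
  · simp only [label, hnd, false_and, if_false]
    refine Finset.eq_empty_of_forall_notMem fun π hπ => hnd ?_
    rw [cylinder, Finset.mem_filter] at hπ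
    rw [← hπ.2]
    exact π.2.nodup.sublist (List.take_sublist _ _)
  obtain ⟨htE, htp, htK, htd⟩ := hT hnd
  have hv : IsInjWord j v := ⟨hnd, hvj⟩
  unfold label
  generalize T (red v) = t at *
  rw [red_take_red hnd (by omega)] at htp
  have hpw : IsPrefixWord j t.perm (v.take t.perm.length) :=
    ⟨fun a ha => hvj a (List.mem_of_mem_take ha), htp.symm⟩
  by_cases hg : ∃ g, IsGapVector B t.perm g ∧
      g ≤ spacing j t.perm.length (v.take t.perm.length)
  · rw [if_neg fun h => h.2 hg]
    obtain ⟨g, hg1, hg2⟩ := hg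
    refine Finset.eq_empty_of_forall_notMem fun π hπ => ?_
    rw [cylinder, Finset.mem_filter] at hπ
    have h1 : π.1.take t.perm.length = v.take t.perm.length := by
      conv_rhs => rw [← hπ.2]
      rw [List.take_take, min_eq_left (by omega)]
    have h2 : π ∈ prefixClass j B t.perm (v.take t.perm.length) :=
      ⟨hπ.1, by rw [h1, htp.symm], h1⟩
    rw [hg1 j _ hpw hg2] at h2
    exact h2
  · rw [if_pos ⟨hnd, hg⟩]
    -- If `0` belonged to the triple's gap vectors, it would lie below the spacing vector, contrary
    -- to `hg`. So something is deleted, and the new length is smaller.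
    have hd : t.del ≠ ∅ := htd.resolve_right fun h =>
      hg ⟨0, hE.gap t htE 0 h, fun i => Nat.zero_le _⟩
    obtain ⟨hR, hbij⟩ := hE.deletable t htE
    have hkv : t.perm.length ≤ v.length := by omega
    have hRv : t.del ⊆ Finset.Icc 1 v.length := hR.trans (Finset.Icc_subset_Icc_right hkv)
    have hcard : t.del.card ≤ t.perm.length := by simpa using Finset.card_le_card hR
    have hpos : 0 < t.del.card := Finset.card_pos.2 (Finset.nonempty_iff_ne_empty.2 hd)
    have hb := bijOn_cylinder hv hkv hLj htp hR
      (hbij j _ hpw fun g hg1 hg2 => hg ⟨g, hg1, hg2⟩)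
    obtain ⟨hv', hext⟩ := deletePerm_extPerm hv hRv hLj
    refine ⟨hv, j - t.del.card, deleteWord t.del v, hv', by omega, ?_,
      moves_deletionMoves hv (by omega), ?_⟩
    · rw [length_deleteWord hRv]; omega
    unfold distribution
    rw [Finset.mul_sum]
    refine Finset.sum_bij (fun π _ => deletePerm t.del π) (fun π hπ => hb.1 hπ)
      (fun π hπ π' hπ' h => hb.2.1 hπ hπ' h) (fun π hπ => ?_) fun π hπ => ?_
    · obtain ⟨π', h1, h2⟩ := hb.2.2 hπ
      exact ⟨π', h1, h2⟩
    · rw [← monomial_add]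
      congr 1
      funext i
      rw [cylinder, Finset.mem_filter, mem_avoiders] at hπ
      have hlen := length_extPerm hv
      -- Taking `t = K + 1` satisfies `t ≥ 1`, covers every `R` in the scheme, and makes `t + m` the
      -- length of `v`.
      have := hf i (K + 1) (by omega) t.del
        (hR.trans (Finset.Icc_subset_Icc_right (by omega))) π (extPerm j v hv)
        (by rw [hlen, hπ.1.1]) (by rw [hπ.1.1]; omega) ?_
      · rw [hext] at this
        simp only [Pi.add_apply]
        omega
      · rw [← hL, hπ.2]
        change v = (v ++ _).take v.length
        rw [List.take_left']
        rfl

/-- Finiteness of the scheme gives a common bound `K` on lengths and a common threshold `M`, so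
finitely many tests determine the label. The tree is chosen before `s` and `f`: the statistics enter
only through the correctness of the labels. -/
theorem exists_tree {B : Set VincularPattern} (hB : HasFiniteScheme B) (m : ℕ) :
    ∃ L, 1 ≤ L ∧ ∃ tree : DTree (L + 2) (Option (List (ℕ × ℤ))),
      ∀ (s : ℕ) (f : Fin s → Permutation → ℤ), (∀ i, ESCompatible (f i) m) →
        ∀ (j : ℕ) (v : List ℕ), L ≤ j → v.length = L → (∀ x ∈ v, 1 ≤ x ∧ x ≤ j) →
          LabelCorrect B f j v (tree.eval (env (L + 2) j v)) := by
  classical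
  obtain ⟨E, hfin, hE⟩ := hB
  obtain ⟨K, hK⟩ : ∃ K, ∀ t ∈ E, t.perm.length ≤ K :=
    ⟨hfin.toFinset.sup fun t => t.perm.length, fun t ht =>
      Finset.le_sup (f := fun t : Triple => t.perm.length) (hfin.mem_toFinset.2 ht)⟩
  have hthr : ∀ t : Triple, ∃ M, ∀ x y, (∀ i, ∀ c ≤ M, c ≤ x i → c ≤ y i) →
      (∃ g, IsGapVector B t.perm g ∧ g ≤ x) → ∃ g, IsGapVector B t.perm g ∧ g ≤ y := fun t =>
    exists_threshold {x | ∃ g, IsGapVector B t.perm g ∧ g ≤ x}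
      fun x y hxy ⟨g, h1, h2⟩ => ⟨g, h1, h2.trans hxy⟩
  choose thr hthr using hthr
  obtain ⟨M, hM⟩ : ∃ M, ∀ t ∈ E, thr t ≤ M :=
    ⟨hfin.toFinset.sup thr, fun t ht => Finset.le_sup (f := thr) (hfin.mem_toFinset.2 ht)⟩
  -- The choice depends on the reduced word alone, so that it takes the same value on words with the
  -- same order. The default triple is never used for words without repetition of length `L`.
  let T : List ℕ → Triple := fun w =>
    if h : ∃ t, Applies E K w t then h.choose else ⟨emptyPerm, ∅, ∅⟩
  set L := K + 1 + m with hL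
  have hT : ∀ v : List ℕ, v.length = L → v.Nodup → Applies E K (red v) (T (red v)) := by
    intro v hv hnd
    have h := exists_applies hE hK (nodup_red hnd) (by rw [length_red]; omega)
    simp only [T, dif_pos h]
    exact h.choose_spec
  obtain ⟨tree, htree⟩ := DTree.exists_eval_eq (X := ℕ × List ℕ)
    (fun x => env (L + 2) x.1 x.2) (fun x => label B T x.1 x.2) (agreeTests (L + 2) M)
    {x | x.2.length = L} fun x hx y hy hxy =>
      (agree_of_tests hxy).label_eq hx hy fun hnd => by
        have h := hT _ hx hnd
        refine ⟨h.2.2.1.trans (by omega), fun x' y' hc => hthr _ x' y' fun i c hcM => ?_⟩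
        exact hc i c (hcM.trans (hM _ h.1))
  refine ⟨L, by omega, tree, fun s f hf j v hLj hv hvj => ?_⟩
  rw [htree (j, v) hv]
  exact labelCorrect_label hE f hf hv (by omega) hvj (hT v hv)

end EnumScheme

/-! ### The final program and its constant -/

theorem mainTheorem7 (B : Set VincularPattern) (hB : HasFiniteScheme B) (s m : ℕ) :
    ∃ (P : Program s) (C : ℕ), ∀ f : Fin s → Permutation → ℤ, (∀ i, ESCompatible (f i) m) →
      ∀ n : ℕ, ∃ (σ : State s) (t u : ℕ),
        Run f P (State.init s n) σ t u ∧
        σ.poly 0 = distribution (avoiders n B) f ∧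
        t ≤ C * (n + 1) ^ C ∧
        u ≤ C * (n + 1) ^ C * (1 + maxValues B f n) := by
  classical
  obtain ⟨L, hL, tree, htree⟩ := exists_tree hB m
  let S : Finset Permutation := (Finset.range L).biUnion fun j => avoiders j B
  have hS : ∀ π, π ∈ S.toList ↔ π.length < L ∧ ∀ τ ∈ B, ¬ Contains π τ := fun π => by
    simp [S, mem_avoiders]
  obtain ⟨C, hC⟩ := polyBounded_mainTime s L tree.depth S.toList.length
  set A := ∑ j ∈ Finset.range (L + 1), (avoiders j B).card
  -- With `N = maxValues B f n`, operands have at most `A + N` terms, and `1 + 2 * (A + N) ≤ (2 * A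
  -- + 2) * (1 + N)`; the factor `2 * A + 2` is absorbed into the constant.
  refine ⟨mainProg L S.toList tree, C * (2 * A + 2), fun f hf n => ?_⟩
  obtain ⟨σ, t, u, hrun, ht, hu, hσ⟩ :=
    exec_mainProg f hL S.toList S.nodup_toList hS tree (htree s f hf) n
  have hpow : C * (n + 1) ^ C ≤ C * (n + 1) ^ (C * (2 * A + 2)) :=
    Nat.mul_le_mul_left _ (Nat.pow_le_pow_right (by omega) (Nat.le_mul_of_pos_right _ (by omega)))
  refine ⟨σ, t, u, hrun, hσ, ?_, ?_⟩
  · refine (ht.trans (hC n)).trans (hpow.trans (Nat.mul_le_mul_right _ ?_))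
    exact Nat.le_mul_of_pos_right _ (by omega)
  · have h1 : _ ≤ A + _ := maxValues_max_le B f n L
    calc u ≤ C * (n + 1) ^ (C * (2 * A + 2)) * (1 + 2 * maxValues B f (max n L)) :=
          hu.trans (Nat.mul_le_mul_right _ ((hC n).trans hpow))
      _ ≤ C * (n + 1) ^ (C * (2 * A + 2)) * ((2 * A + 2) * (1 + maxValues B f n)) := by
          refine Nat.mul_le_mul_left _ ?_
          nlinarith
      _ = _ := by ring
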